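/- **Setting.** Let $0<\beta<1$, $q>0$, $b\ge 0$. Consider the following system with state $(v,y)$, $0\le y\le b$. Between jumps $$\frac{dv}{ds}=1,\qquad \frac{dy}{ds}=\begin{cases}0,&\text{if } y=0,\ v<q,\ \text{ or } y=b,\ v>q+b;\\ v-y-q,&\text{otherwise.}\end{cases}$$ If $s^*$ is a moment when $y$ reaches the value $b$ and overflow starts (that is, $y=b$, $v\ge q+b$ begins to hold), then at the moment $s^*+1$ the component $v$ jumps: $$v(s^*+1+0)=\beta^k v(s^*+1-0),\qquad k=\min\{i:\ \beta^i v(s^*+1-0)<b+q\},$$ and $v$ is continuous at all other moments. A *cycle* is a finite trajectory that starts at $s=0$ from a point with $y(0)=b$, $v(0)<b+q$ and returns to this same point, for the first time, at some moment $S\ge 1$ ($v$ being taken right-continuous); cycles which trace out the same closed curve are identified. A cycle has *order* $k$ if it contains exactly one jump moment and $v$ is multiplied by $\beta^k$ there. **Notation.** Put $$N=\min\Big\{i\ge1:\frac{\beta^i}{1-\beta^i}<q\Big\},\quad D=\ln(1-\beta^N)+\frac{2\beta^N}{1-\beta^N},\quad C=-\ln(1-\beta^N)-\beta^N;$$ let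 $\tau_2$ be the single positive solution of $$\frac{\tau}{1+\frac{\beta-\beta^2}{1-\beta^2}(\tau+1)}=1-e^{-\tau},$$ and $$A_2^*=\frac{\beta(\tau_2+1)}{1-\beta^2},\qquad q_2^*=\frac{\beta^2}{1-\beta^2}(\tau_2+1)+\ln\frac{\tau_2}{1-e^{-\tau_2}}.$$ In case $q\le D$, let $\underline r\le\bar r$ be the smallest and the largest positive solution of $e^{-r}+r-1=\beta^N(q+r+1)-q$, and put $\underline b=e^{-\underline r}+\underline r-1$, $\bar b=e^{-\bar r}+\bar r-1$. (These are used only in conditions (c) and (d), where $N=1$ and $q\le D$.) **Theorem.** The following six conditions are mutually exclusive, and one of them holds if and only if only a single cycle exists and it is of order $1$ (so that multiple jumps do not occur): (a) $\frac{\beta}{1-\beta}\ge q$ and $b+q>A_2^*$; (b) $A_2^*<q$ ($b$ can be arbitrary); (c) $\frac{\beta}{1-\beta}<q\le q_2^*$ and $b\notin[\underline b,\,A_2^*-q]$; (d) $\max\{\frac{\beta}{1-\beta},\,q_2^*\}<q\le A_2^*-C$, $q\le D$ and $b\notin[\underline b,\bar b]$; (e) $\max\{\frac{\beta}{1-\beta},\,q_2^*\}<q\le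 A_2^*-C$ and $q>D$ ($b$ can be arbitrary); (f) $\max\{\frac{\beta}{1-\beta},\,q_2^*,\,A_2^*-C\}<q\le A_2^*$ ($b$ can be arbitrary). -/

import Mathlib

open Set Filter Topology

noncomputable section

namespace TCPBuffer

/-! ## The dynamics

Parameters: `β` is the multiplicative decrease factor, `q` the (normalised) bandwidth-delay product,
`b` the (normalised) buffer size; `v` is the normalised congestion window and `y` the normalised
amount of data in the buffer.  Time is counted in round trip times. -/

/-- The right-hand side of the equation for `y` in the region `0 ≤ y ≤ b`: the queue changes at rate
`v - y - q`, except that an empty queue stays empty while `v < q` and a full buffer stays full while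
`v > q + b`.  (Written through the exceptional cases, so that it also makes sense for `b = 0`, where
the buffer is always both empty and full.) -/
def queueRate (q b v y : ℝ) : ℝ :=
  open Classical in
  if (y = 0 ∧ v < q) ∨ (y = b ∧ q + b < v) then 0 else v - y - q

/-- At time `s` the buffer is full and the input rate is at least the service rate. -/
def Full (q b : ℝ) (v y : ℝ → ℝ) (s : ℝ) : Prop :=
  y s = b ∧ q + b ≤ v s

/-- The moment `s` at which `y` reaches the value `b` and the buffer starts to overflow.  If `b > 0`
and `y` comes from below `b`, then `v ≥ q + b` holds automatically when `y` reaches `b`; for `b = 0`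
this is the moment at which `v` reaches `q`. -/
def OverflowStart (q b : ℝ) (v y : ℝ → ℝ) (s : ℝ) : Prop :=
  0 ≤ s ∧ Full q b v y s ∧ ∀ᶠ u in 𝓝[<] s, ¬ Full q b v y u

/-- The overflow is noticed one round trip time after it has started. -/
def JumpTime (q b : ℝ) (v y : ℝ → ℝ) (s : ℝ) : Prop :=
  OverflowStart q b v y (s - 1)

/-- At time `s` the left limit `v (s - 0)` is multiplied by `β ^ k`, where `k` is the smallest
number of reductions that brings `v` strictly below `b + q`. -/
def JumpOfOrder (β q b : ℝ) (v : ℝ → ℝ) (s : ℝ) (k : ℕ) : Prop :=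
  ∃ vl : ℝ, Tendsto v (𝓝[<] s) (𝓝 vl) ∧
    IsLeast {i : ℕ | β ^ i * vl < b + q} k ∧ v s = β ^ k * vl

/-- `(v, y)` is a trajectory of the system on the time interval `[0, S]` that starts from a full
buffer `y = b` with `v < b + q`.  Trajectories are right-continuous at jump times, so `v s` is the
value just after the jump; derivatives are derivatives from the right. -/
structure IsTrajectory (β q b : ℝ) (v y : ℝ → ℝ) (S : ℝ) : Prop where
  init_y : y 0 = b
  init_v : v 0 < b + q
  mem_y : ∀ s ∈ Icc 0 S, y s ∈ Icc 0 b
  cont_y : ContinuousOn y (Icc 0 S)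
  deriv_v : ∀ s ∈ Ico 0 S, HasDerivWithinAt v 1 (Ici s) s
  deriv_y : ∀ s ∈ Ico 0 S, HasDerivWithinAt y (queueRate q b (v s) (y s)) (Ici s) s
  cont_v : ∀ s ∈ Ioc 0 S, ¬ JumpTime q b v y s → Tendsto v (𝓝[<] s) (𝓝 (v s))
  jump_v : ∀ s ∈ Ioc 0 S, JumpTime q b v y s → ∃ k : ℕ, JumpOfOrder β q b v s k

/-- A cycle: a trajectory that starts from `y = b`, `v < b + q` and returns to its starting point for
the first time at time `S ≥ 1`.  (It may a priori contain several jump times.) -/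
structure IsCycle (β q b : ℝ) (v y : ℝ → ℝ) (S : ℝ) : Prop where
  traj : IsTrajectory β q b v y S
  one_le : 1 ≤ S
  first_return : IsLeast {s : ℝ | 0 < s ∧ v s = v 0 ∧ y s = y 0} S

/-- A cycle of order `k` (a `k`-cycle): it has a single jump time, at which `k` instantaneous
reductions of `v` are made. -/
def IsCycleOfOrder (β q b : ℝ) (v y : ℝ → ℝ) (S : ℝ) (k : ℕ) : Prop :=
  IsCycle β q b v y S ∧
    ∃ s ∈ Ioc 0 S, (∀ u ∈ Ioc 0 S, JumpTime q b v y u ↔ u = s) ∧ JumpOfOrder β q b v s k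

/-- The closed curve in the `(v, y)` plane that is traced out by a cycle.  Cycles are identified
when they trace out the same curve, since the choice of the starting point on it is immaterial. -/
def orbit (v y : ℝ → ℝ) (S : ℝ) : Set (ℝ × ℝ) :=
  (fun s => (v s, y s)) '' Ico 0 S

/-- Only a single cycle exists, and it is of order `1`. -/
def OnlySingleCycleOfOrderOne (β q b : ℝ) : Prop :=
  ∃ (v y : ℝ → ℝ) (S : ℝ), IsCycleOfOrder β q b v y S 1 ∧
    ∀ (v' y' : ℝ → ℝ) (S' : ℝ), IsCycle β q b v' y' S' → orbit v' y' S' = orbit v y S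

/-! ## The quantities that enter the conditions -/

/-- `N = min {i ≥ 1 : β ^ i / (1 - β ^ i) < q}`. -/
def N (β q : ℝ) : ℕ := sInf {i : ℕ | 1 ≤ i ∧ β ^ i / (1 - β ^ i) < q}

def D (β q : ℝ) : ℝ :=
  Real.log (1 - β ^ N β q) + 2 * β ^ N β q / (1 - β ^ N β q)

def C (β q : ℝ) : ℝ := -Real.log (1 - β ^ N β q) - β ^ N β q

/-- `τ_k`, `k ≥ 2`: the single positive solution of its equation, picked out as the infimum of the
set of positive solutions. -/
def tau (β : ℝ) (k : ℕ) : ℝ :=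
  sInf {t : ℝ | 0 < t ∧
    t / (1 + (β ^ (k - 1) - β ^ k) / (1 - β ^ k) * (t + 1)) = 1 - Real.exp (-t)}

/-- `A*_k`, `k ≥ 2`. -/
def AStar (β : ℝ) (k : ℕ) : ℝ := β ^ (k - 1) * (tau β k + 1) / (1 - β ^ k)

/-- `q*_k`, `k ≥ 2`. -/
def qStar (β : ℝ) (k : ℕ) : ℝ :=
  β ^ k / (1 - β ^ k) * (tau β k + 1) + Real.log (tau β k / (1 - Real.exp (-tau β k)))

/-- The positive solutions `r` of `e⁻ʳ + r - 1 = β ^ N (q + r + 1) - q`. -/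
def rSolutions (β q : ℝ) : Set ℝ :=
  {r : ℝ | 0 < r ∧ Real.exp (-r) + r - 1 = β ^ N β q * (q + r + 1) - q}

/-- The smaller and the larger positive solution; there are no more than two, and they are only used
when `q ≤ D` (if there is just one, the two coincide). -/
def rLow (β q : ℝ) : ℝ := sInf (rSolutions β q)

def rHigh (β q : ℝ) : ℝ := sSup (rSolutions β q)

def bLow (β q : ℝ) : ℝ := Real.exp (-rLow β q) + rLow β q - 1

def bHigh (β q : ℝ) : ℝ := Real.exp (-rHigh β q) + rHigh β q - 1

/-! ## The six conditions -/

def CondA (β q b : ℝ) : Prop := q ≤ β / (1 - β) ∧ AStar β 2 < b + q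

def CondB (β q : ℝ) : Prop := AStar β 2 < q

def CondC (β q b : ℝ) : Prop :=
  β / (1 - β) < q ∧ q ≤ qStar β 2 ∧ b ∉ Icc (bLow β q) (AStar β 2 - q)

def CondD (β q b : ℝ) : Prop :=
  max (β / (1 - β)) (qStar β 2) < q ∧ q ≤ AStar β 2 - C β q ∧ q ≤ D β q ∧
    b ∉ Icc (bLow β q) (bHigh β q)

def CondE (β q : ℝ) : Prop :=
  max (β / (1 - β)) (qStar β 2) < q ∧ q ≤ AStar β 2 - C β q ∧ D β q < q

def CondF (β q : ℝ) : Prop :=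
  max (max (β / (1 - β)) (qStar β 2)) (AStar β 2 - C β q) < q ∧ q ≤ AStar β 2

/-- The list of the conditions (a)–(f). -/
def conditions (β q b : ℝ) : List Prop :=
  [CondA β q b, CondB β q, CondC β q b, CondD β q b, CondE β q, CondF β q]

end TCPBuffer

end

/-!
The proof reduces the dynamics to a map of an interval. Suppose that the buffer is full and that
`v = b + q - a` with `a > 0`. Until the reaction to the next overflow `v` grows at unit rate, so
the queue solves a scalar equation. Its right-hand side is discontinuous, but nonincreasing in
`y`, so the solution is unique (`IsQueue.eqOn`), and it can be written down (`exists_isProfile`).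
If the buffer does not run empty, the overflow starts after the time `t` with
`t / (1 - e⁻ᵗ) = a + 1`; otherwise it starts at `v = q + r`, where `e⁻ʳ + r - 1 = b`. In both
cases it is the smaller of the two candidates that counts (`overflowTime`). Hence `v` attains the
value `peak q b x` when it starts from `x`, and the next jump leads to `β ^ k * peak q b x`. The
function `peak` is nonincreasing and nonexpanding in `x` (`abs_peak_sub_le`), because the slope of
`t / (1 - e⁻ᵗ)` lies between `1 / 2` and `1`.

After a jump, `v ≥ β (b + q)`. If a single reduction suffices for `x = β (b + q)`, that is, if
`β * peak q b (β (b + q)) < b + q` (`SingleReduction`), then the return map is the contraction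
`x ↦ β * peak q b x` on `[β (b + q), b + q)`. Its fixed point gives a cycle of order `1`
(`exists_cycle`), and for `b > 0` every cycle, whatever its number of jumps, starts from that
point (`IsTrajectory.contraction`). Otherwise, if a cycle of order `1` exists and `b > 0`, then
`x ↦ β² * peak q b x` has a fixed point at which two reductions are needed, so a second cycle
exists. For `b = 0` the buffer is full all the time, cycles can start anywhere with `v < q`, and
the orbit is computed directly (`IsCycle.orbit_of_zero`).

It remains to express `SingleReduction` by the six conditions. As `peak` is a minimum of two
terms, it holds if and only if `b + q > AStar β 2` or `gap β q r > 0`, where `r` is the fill time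
of the buffer (`singleReduction_iff`). The function `gap β q` decreases up to `- log (1 - β)` and
increases afterwards; `q ≤ D` says that its minimum is nonpositive, and the value `C` of `b`
belongs to the minimum. The sign of `gap` at the level `b + q = AStar β 2` is decided by comparing
`q` with `qStar β 2` (`gap_AStar_nonpos`, `gap_AStar_pos`), which places `AStar β 2 - q` relative
to `bLow` and `bHigh`. In the range `q ≤ β / (1 - β)`, where `gap` is nonpositive at `0`, the
second alternative implies the first, due to the inequality `β / (1 - β) ≤ qStar β 2`
(`le_qStar`).
-/

noncomputable section

namespace TCPBuffer

/-! ### Refilling an empty buffer -/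

/-- The amount of data in an initially empty buffer when a time `r` has passed since `v = q`:
the solution of `y' = r - y`, `y(0) = 0`. -/
def refill (r : ℝ) : ℝ := Real.exp (-r) + r - 1

lemma hasDerivAt_refill (r : ℝ) : HasDerivAt refill (1 - Real.exp (-r)) r := by
  have h : HasDerivAt refill (Real.exp (-r) * (-1) + 1) r :=
    (((hasDerivAt_neg r).exp).add (hasDerivAt_id r)).sub_const 1
  convert h using 1
  ring

lemma continuous_refill : Continuous refill := by
  unfold refill
  fun_prop

@[simp] lemma refill_zero : refill 0 = 0 := by simp [refill]

lemma refill_strictMonoOn : StrictMonoOn refill (Ici 0) := by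
  refine strictMonoOn_of_deriv_pos (convex_Ici 0) continuous_refill.continuousOn fun r hr => ?_
  rw [interior_Ici, mem_Ioi] at hr
  rw [(hasDerivAt_refill r).deriv, sub_pos, Real.exp_lt_one_iff]
  linarith

lemma exists_refill_eq {b : ℝ} (hb : 0 ≤ b) : ∃ r, 0 ≤ r ∧ refill r = b := by
  have h := intermediate_value_Icc (show (0 : ℝ) ≤ b + 1 by linarith) continuous_refill.continuousOn
  have hmem : b ∈ Icc (refill 0) (refill (b + 1)) := by
    refine ⟨by simpa using hb, ?_⟩
    have := Real.exp_pos (-(b + 1))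
    unfold refill
    linarith
  obtain ⟨r, hr, hrb⟩ := h hmem
  exact ⟨r, hr.1, hrb⟩

/-- The time that an empty buffer of size `b` takes to fill up from the moment when `v = q`; it is
`0` for `b < 0`. -/
def fillTime (b : ℝ) : ℝ :=
  open Classical in if h : 0 ≤ b then Classical.choose (exists_refill_eq h) else 0

lemma fillTime_nonneg (b : ℝ) : 0 ≤ fillTime b := by
  unfold fillTime
  split_ifs with h
  · exact (Classical.choose_spec (exists_refill_eq h)).1
  · exact le_rfl

lemma refill_fillTime {b : ℝ} (hb : 0 ≤ b) : refill (fillTime b) = b := by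
  unfold fillTime
  rw [dif_pos hb]
  exact (Classical.choose_spec (exists_refill_eq hb)).2

@[simp] lemma fillTime_zero : fillTime 0 = 0 :=
  refill_strictMonoOn.injOn (fillTime_nonneg 0) self_mem_Ici
    (by rw [refill_fillTime le_rfl, refill_zero])

lemma le_fillTime {b : ℝ} (hb : 0 ≤ b) : b ≤ fillTime b := by
  have h1 := refill_fillTime hb
  have h2 : Real.exp (-fillTime b) ≤ 1 := by
    rw [Real.exp_le_one_iff]
    linarith [fillTime_nonneg b]
  unfold refill at h1
  linarith

/-! ### The overflow time when the buffer does not run empty -/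

/-- The function `t / (1 - e⁻ᵗ)`, which links the time `t` between two overflows to the deficit
`a = b + q - v` after the jump by `expRatio t = a + 1`, as long as the buffer does not run empty. -/
def expRatio (t : ℝ) : ℝ := t / (1 - Real.exp (-t))

lemma one_sub_exp_neg_pos {t : ℝ} (ht : 0 < t) : 0 < 1 - Real.exp (-t) := by
  rw [sub_pos, Real.exp_lt_one_iff]
  linarith

lemma hasDerivAt_expRatio {t : ℝ} (ht : 0 < t) : HasDerivAt expRatio
    ((1 - Real.exp (-t) - t * Real.exp (-t)) / (1 - Real.exp (-t)) ^ 2) t := by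
  have h : HasDerivAt (fun t : ℝ => 1 - Real.exp (-t)) (Real.exp (-t)) t := by
    simpa using ((hasDerivAt_neg t).exp).const_sub 1
  unfold expRatio
  simpa using (hasDerivAt_id' t).fun_div h (one_sub_exp_neg_pos ht).ne'

lemma monotoneOn_sub_expRatio : MonotoneOn (fun t => t - expRatio t) (Ioi 0) := by
  have hd : ∀ t ∈ Ioi (0 : ℝ), HasDerivAt (fun t => t - expRatio t)
      (1 - (1 - Real.exp (-t) - t * Real.exp (-t)) / (1 - Real.exp (-t)) ^ 2) t :=
    fun t ht => (hasDerivAt_id t).sub (hasDerivAt_expRatio ht)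
  refine monotoneOn_of_deriv_nonneg (convex_Ioi 0)
    (fun t ht => (hd t ht).continuousAt.continuousWithinAt)
    (fun t ht => (hd t (interior_subset ht)).differentiableAt.differentiableWithinAt) fun t ht => ?_
  have ht' := interior_subset ht
  rw [(hd t ht').deriv]
  have h1 := one_sub_exp_neg_pos ht'
  rw [sub_nonneg, div_le_one (by positivity)]
  nlinarith [Real.add_one_le_exp (-t), Real.exp_pos (-t)]

lemma monotoneOn_expRatio_sub_half : MonotoneOn (fun t => expRatio t - t / 2) (Ioi 0) := by
  have hd : ∀ t ∈ Ioi (0 : ℝ), HasDerivAt (fun t => expRatio t - t / 2)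
      ((1 - Real.exp (-t) - t * Real.exp (-t)) / (1 - Real.exp (-t)) ^ 2 - 1 / 2) t :=
    fun t ht => (hasDerivAt_expRatio ht).sub ((hasDerivAt_id t).div_const 2)
  refine monotoneOn_of_deriv_nonneg (convex_Ioi 0)
    (fun t ht => (hd t ht).continuousAt.continuousWithinAt)
    (fun t ht => (hd t (interior_subset ht)).differentiableAt.differentiableWithinAt) fun t ht => ?_
  have ht' : 0 < t := interior_subset ht
  rw [(hd t ht').deriv]
  have h1 := one_sub_exp_neg_pos ht'
  rw [sub_nonneg, div_le_div_iff₀ (by norm_num) (by positivity)]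
  -- the inequality is `t ≤ sinh t`, multiplied by `2 e⁻ᵗ`
  have h2 := Real.self_le_sinh_iff.2 ht'.le
  rw [Real.sinh_eq] at h2
  have h3 : Real.exp t * Real.exp (-t) = 1 := by rw [← Real.exp_add]; simp
  nlinarith [Real.exp_pos (-t)]

lemma expRatio_sub_le {s t : ℝ} (hs : 0 < s) (hst : s ≤ t) : expRatio t - expRatio s ≤ t - s := by
  have := monotoneOn_sub_expRatio hs (hs.trans_le hst) hst
  simp only at this
  linarith

lemma half_le_expRatio_sub {s t : ℝ} (hs : 0 < s) (hst : s ≤ t) :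
    (t - s) / 2 ≤ expRatio t - expRatio s := by
  have := monotoneOn_expRatio_sub_half hs (hs.trans_le hst) hst
  simp only at this
  linarith

lemma expRatio_strictMonoOn : StrictMonoOn expRatio (Ioi 0) := by
  intro s hs t _ hst
  linarith [half_le_expRatio_sub hs hst.le]

lemma exists_expRatio_eq {a : ℝ} (ha : 0 < a) : ∃ t, a < t ∧ t < a + 1 ∧ expRatio t = a + 1 := by
  have hc : ContinuousOn expRatio (Icc a (a + 1)) := fun t ht =>
    (hasDerivAt_expRatio (ha.trans_le ht.1)).continuousAt.continuousWithinAt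
  have h := intermediate_value_Ioo (show a ≤ a + 1 by linarith) hc
  have hmem : a + 1 ∈ Ioo (expRatio a) (expRatio (a + 1)) := by
    constructor
    · unfold expRatio
      rw [div_lt_iff₀ (one_sub_exp_neg_pos ha)]
      have h1 := Real.add_one_lt_exp ha.ne'
      have h3 : Real.exp a * Real.exp (-a) = 1 := by rw [← Real.exp_add]; simp
      nlinarith [Real.exp_pos (-a)]
    · unfold expRatio
      rw [lt_div_iff₀ (one_sub_exp_neg_pos (by linarith))]
      nlinarith [Real.exp_pos (-(a + 1))]
  obtain ⟨t, ht, hta⟩ := h hmem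
  exact ⟨t, ht.1, ht.2, hta⟩

/-- The time until the next overflow from a full buffer with `v = b + q - a`, if the buffer does not
run empty in between; it is `0` for `a ≤ 0`. -/
def freeTime (a : ℝ) : ℝ :=
  open Classical in if h : 0 < a then Classical.choose (exists_expRatio_eq h) else 0

lemma freeTime_spec {a : ℝ} (ha : 0 < a) :
    a < freeTime a ∧ freeTime a < a + 1 ∧ expRatio (freeTime a) = a + 1 := by
  unfold freeTime
  rw [dif_pos ha]
  exact Classical.choose_spec (exists_expRatio_eq ha)

lemma freeTime_pos {a : ℝ} (ha : 0 < a) : 0 < freeTime a := ha.trans (freeTime_spec ha).1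

lemma freeTime_eq {a t : ℝ} (ha : 0 < a) (ht : 0 < t) (h : expRatio t = a + 1) :
    freeTime a = t :=
  expRatio_strictMonoOn.injOn (freeTime_pos ha) ht ((freeTime_spec ha).2.2.trans h.symm)

lemma freeTime_mono {a a' : ℝ} (ha : 0 < a) (h : a ≤ a') : freeTime a ≤ freeTime a' := by
  have ha' := ha.trans_le h
  rw [← expRatio_strictMonoOn.le_iff_le (freeTime_pos ha) (freeTime_pos ha'),
    (freeTime_spec ha).2.2, (freeTime_spec ha').2.2]
  linarith

/-! ### The overflow time in general -/

/-- The time until the next overflow from a full buffer with `v = b + q - a`.  The second term is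
the overflow time if the buffer runs empty: then `v = q` at time `a - b`. -/
def overflowTime (b a : ℝ) : ℝ := min (freeTime a) (a - b + fillTime b)

/-- The amount by which `v` exceeds `b + q` when the overflow starts. -/
def excess (b a : ℝ) : ℝ := overflowTime b a - a

lemma excess_eq (b a : ℝ) : excess b a = min (freeTime a - a) (fillTime b - b) := by
  unfold excess overflowTime
  rw [← min_sub_sub_right]
  congr 1
  ring

lemma excess_nonneg {b a : ℝ} (hb : 0 ≤ b) (ha : 0 < a) : 0 ≤ excess b a := by
  rw [excess_eq]
  exact le_min (sub_nonneg.2 (freeTime_spec ha).1.le) (sub_nonneg.2 (le_fillTime hb))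

lemma excess_le_one {b a : ℝ} (ha : 0 < a) : excess b a ≤ 1 := by
  rw [excess_eq]
  exact (min_le_left _ _).trans (by linarith [(freeTime_spec ha).2.1])

lemma excess_zero {a : ℝ} (ha : 0 < a) : excess 0 a = 0 := by
  rw [excess_eq]
  simp [(freeTime_spec ha).1.le]

lemma freeTime_sub_mono {a a' : ℝ} (ha : 0 < a) (h : a ≤ a') :
    freeTime a - a ≤ freeTime a' - a' := by
  have h1 := expRatio_sub_le (freeTime_pos ha) (freeTime_mono ha h)
  rw [(freeTime_spec ha).2.2, (freeTime_spec (ha.trans_le h)).2.2] at h1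
  linarith

lemma freeTime_sub_le {a a' : ℝ} (ha : 0 < a) (h : a ≤ a') :
    freeTime a' - a' ≤ freeTime a - a + (a' - a) := by
  have h1 := half_le_expRatio_sub (freeTime_pos ha) (freeTime_mono ha h)
  rw [(freeTime_spec ha).2.2, (freeTime_spec (ha.trans_le h)).2.2] at h1
  linarith

lemma excess_mono {b a a' : ℝ} (ha : 0 < a) (h : a ≤ a') : excess b a ≤ excess b a' := by
  rw [excess_eq, excess_eq]
  exact min_le_min_right _ (freeTime_sub_mono ha h)

lemma excess_le_add {b a a' : ℝ} (ha : 0 < a) (h : a ≤ a') :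
    excess b a' ≤ excess b a + (a' - a) := by
  rw [excess_eq, excess_eq, ← min_add_add_right]
  exact min_le_min (freeTime_sub_le ha h) (by linarith)

/-- The excess is a nonexpanding function of the deficit.  Multiplied by `β`, it makes the return
map a contraction on each piece where the number of reductions is constant. -/
lemma abs_excess_sub_le {b a a' : ℝ} (ha : 0 < a) (ha' : 0 < a') :
    |excess b a - excess b a'| ≤ |a - a'| := by
  rcases le_total a a' with h | h
  · rw [abs_sub_comm, abs_sub_comm a, abs_of_nonneg (sub_nonneg.2 (excess_mono ha h)),
      abs_of_nonneg (sub_nonneg.2 h)]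
    linarith [excess_le_add (b := b) ha h]
  · rw [abs_of_nonneg (sub_nonneg.2 (excess_mono ha' h)), abs_of_nonneg (sub_nonneg.2 h)]
    linarith [excess_le_add (b := b) ha' h]

lemma continuousOn_excess (b : ℝ) : ContinuousOn (excess b) (Ioi 0) := by
  have : LipschitzOnWith 1 (excess b) (Ioi 0) := by
    refine LipschitzOnWith.of_dist_le_mul fun a ha a' ha' => ?_
    simpa [Real.dist_eq] using abs_excess_sub_le ha ha'
  exact this.continuousOn

lemma overflowTime_pos {b a : ℝ} (hb : 0 ≤ b) (ha : 0 < a) : 0 < overflowTime b a := by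
  have := excess_nonneg hb ha
  unfold excess at this
  linarith

lemma le_overflowTime {b a : ℝ} (hb : 0 ≤ b) (ha : 0 < a) : a ≤ overflowTime b a :=
  sub_nonneg.1 (excess_nonneg hb ha)

/-! ### The equation of the queue -/

/-- On `[s, t]`, the function `y` is a solution of the equation of the queue, driven by `v`. -/
structure IsQueue (q b : ℝ) (v y : ℝ → ℝ) (s t : ℝ) : Prop where
  cont : ContinuousOn y (Icc s t)
  mem : ∀ u ∈ Icc s t, y u ∈ Icc 0 b
  deriv : ∀ u ∈ Ico s t, HasDerivWithinAt y (queueRate q b (v u) (y u)) (Ici u) u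

lemma queueRate_eq {q b v y : ℝ} (h0 : y = 0 → q ≤ v) (hb : y = b → v ≤ q + b) :
    queueRate q b v y = v - y - q := by
  unfold queueRate
  rw [if_neg]
  rintro (⟨h, hv⟩ | ⟨h, hv⟩)
  · exact hv.not_ge (h0 h)
  · exact hv.not_ge (hb h)

lemma queueRate_full {q b v : ℝ} (hv : q + b ≤ v) : queueRate q b v b = 0 := by
  unfold queueRate
  split_ifs with h
  · rfl
  · push Not at h
    linarith [h.2 rfl]

lemma queueRate_empty {q b v : ℝ} (hv : v < q) : queueRate q b v 0 = 0 :=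
  if_pos (Or.inl ⟨rfl, hv⟩)

/-- The rate is nonincreasing in `y`.  This gives uniqueness for the initial value problem, in spite
of the discontinuities of the rate. -/
lemma queueRate_anti {q b v y z : ℝ} (hy : 0 ≤ y) (hz : z ≤ b) (hyz : y ≤ z) :
    queueRate q b v z ≤ queueRate q b v y := by
  unfold queueRate
  split_ifs with h1 h2 h2
  · exact le_rfl
  · rcases h1 with ⟨h, hv⟩ | ⟨h, hv⟩
    · exact absurd (Or.inl ⟨by linarith, hv⟩) h2
    · linarith
  · rcases h2 with ⟨h, hv⟩ | ⟨h, hv⟩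
    · linarith
    · exact absurd (Or.inr ⟨by linarith, hv⟩) h1
  · linarith

lemma IsQueue.congr {q b s t : ℝ} {v w y : ℝ → ℝ} (h : IsQueue q b v y s t)
    (hvw : ∀ u ∈ Ico s t, v u = w u) : IsQueue q b w y s t :=
  ⟨h.cont, h.mem, fun u hu => hvw u hu ▸ h.deriv u hu⟩

lemma IsQueue.mono {q b s t t' : ℝ} {v y : ℝ → ℝ} (h : IsQueue q b v y s t) (ht : t' ≤ t) :
    IsQueue q b v y s t' :=
  ⟨h.cont.mono (Icc_subset_Icc_right ht), fun u hu => h.mem u (Icc_subset_Icc_right ht hu),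
    fun u hu => h.deriv u (Ico_subset_Ico_right ht hu)⟩

lemma IsQueue.eqOn {q b s t : ℝ} {v y z : ℝ → ℝ} (hy : IsQueue q b v y s t)
    (hz : IsQueue q b v z s t) (h0 : y s = z s) : EqOn y z (Icc s t) := by
  have hle : ∀ u ∈ Icc s t, (y u - z u) ^ 2 ≤ 0 := by
    refine image_le_of_deriv_right_le_deriv_boundary (B := fun _ => 0) (B' := fun _ => 0)
      ((hy.cont.sub hz.cont).pow 2)
      (fun u hu => (((hy.deriv u hu).sub (hz.deriv u hu)).pow 2)) (by simp [h0])
      continuousOn_const (fun u _ => hasDerivWithinAt_const _ _ _) fun u hu => ?_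
    have hyu := hy.mem u (Ico_subset_Icc_self hu)
    have hzu := hz.mem u (Ico_subset_Icc_self hu)
    rcases le_total (y u) (z u) with h | h
    · have := queueRate_anti (q := q) (v := v u) hyu.1 hzu.2 h
      simp
      nlinarith
    · have := queueRate_anti (q := q) (v := v u) hzu.1 hyu.2 h
      simp
      nlinarith
  intro u hu
  exact sub_eq_zero.1 (pow_eq_zero_iff two_ne_zero |>.1 (le_antisymm (hle u hu) (sq_nonneg _)))

lemma isQueue_of_hasDerivAt {q b s t : ℝ} {v y y' : ℝ → ℝ} (hd : ∀ u, HasDerivAt y (y' u) u)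
    (hmem : ∀ u ∈ Icc s t, y u ∈ Icc 0 b)
    (hr : ∀ u ∈ Ico s t, queueRate q b (v u) (y u) = y' u) : IsQueue q b v y s t :=
  ⟨fun u _ => (hd u).continuousAt.continuousWithinAt, hmem,
    fun u hu => (hr u hu).symm ▸ (hd u).hasDerivWithinAt⟩

lemma IsQueue.glue {q b s t r : ℝ} {v y z : ℝ → ℝ} (hy : IsQueue q b v y s t)
    (hz : IsQueue q b v z t r) (hst : s ≤ t) (htr : t ≤ r) (h : y t = z t) :
    IsQueue q b v (fun u => if u < t then y u else z u) s r := by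
  have hyeq : ∀ u ∈ Icc s t, (if u < t then y u else z u) = y u := by
    intro u hu
    split_ifs with hut
    · rfl
    · rw [le_antisymm hu.2 (not_lt.1 hut), h]
  have hzeq : ∀ u ∈ Ici t, (if u < t then y u else z u) = z u := fun u hu =>
    if_neg (not_lt.2 hu)
  refine ⟨?_, fun u hu => ?_, fun u hu => ?_⟩
  · rw [← Icc_union_Icc_eq_Icc hst htr]
    exact (hy.cont.congr hyeq).union_of_isClosed (hz.cont.congr fun u hu => hzeq u hu.1)
      isClosed_Icc isClosed_Icc
  · rcases le_total u t with hut | hut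
    · have := hyeq u ⟨hu.1, hut⟩
      simp only [this]
      exact hy.mem u ⟨hu.1, hut⟩
    · have := hzeq u hut
      simp only [this]
      exact hz.mem u ⟨hut, hu.2⟩
  · rcases lt_or_ge u t with hut | hut
    · have h1 := hyeq u ⟨hu.1, hut.le⟩
      simp only [h1]
      refine (hy.deriv u ⟨hu.1, hut⟩).congr_of_eventuallyEq ?_ h1
      filter_upwards [mem_nhdsWithin_of_mem_nhds (Iio_mem_nhds hut)] with x hx
      exact if_pos hx
    · have h1 := hzeq u hut
      simp only [h1]
      exact (hz.deriv u ⟨hut, hu.2⟩).congr (fun x hx => hzeq x (hut.trans hx)) h1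

/-! ### The queue between two overflows -/

/-- The solution of `y' = v - y - q` with `v = b + q - a + s` and `y(0) = b`. -/
def freeQueue (b a s : ℝ) : ℝ := b - a - 1 + s + (a + 1) * Real.exp (-s)

lemma hasDerivAt_freeQueue (b a s : ℝ) :
    HasDerivAt (freeQueue b a) (1 - (a + 1) * Real.exp (-s)) s := by
  have h : HasDerivAt (fun s => b - a - 1 + s + (a + 1) * Real.exp (-s))
      (1 + (a + 1) * (Real.exp (-s) * (-1))) s :=
    ((hasDerivAt_id' s).const_add _).add (((hasDerivAt_neg s).exp).const_mul (a + 1))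
  have he : 1 - (a + 1) * Real.exp (-s) = 1 + (a + 1) * (Real.exp (-s) * (-1)) := by ring
  rw [he]
  exact h

lemma freeQueue_zero (b a : ℝ) : freeQueue b a 0 = b := by simp [freeQueue]

lemma freeQueue_lt_iff {b a s : ℝ} (ha : 0 < a) (hs : 0 < s) :
    freeQueue b a s < b ↔ s < freeTime a := by
  rw [← expRatio_strictMonoOn.lt_iff_lt hs (freeTime_pos ha), (freeTime_spec ha).2.2]
  unfold expRatio freeQueue
  rw [div_lt_iff₀ (one_sub_exp_neg_pos hs)]
  constructor <;> intro h <;> linarith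

lemma freeQueue_le_iff {b a s : ℝ} (ha : 0 < a) (hs : 0 < s) :
    freeQueue b a s ≤ b ↔ s ≤ freeTime a := by
  rw [← expRatio_strictMonoOn.le_iff_le hs (freeTime_pos ha), (freeTime_spec ha).2.2]
  unfold expRatio freeQueue
  rw [div_le_iff₀ (one_sub_exp_neg_pos hs)]
  constructor <;> intro h <;> linarith

lemma freeQueue_freeTime {b a : ℝ} (ha : 0 < a) : freeQueue b a (freeTime a) = b := by
  have h := (freeTime_spec ha).2.2
  unfold expRatio at h
  rw [div_eq_iff (one_sub_exp_neg_pos (freeTime_pos ha)).ne'] at h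
  unfold freeQueue
  linarith

lemma freeQueue_eq (b a s : ℝ) (ha : 0 < a) :
    freeQueue b a s = b - a - 1 + s + Real.exp (Real.log (1 + a) - s) := by
  rw [freeQueue, sub_eq_add_neg (Real.log _), Real.exp_add, Real.exp_log (by linarith),
    add_comm 1 a]

/-- The minimum of the free solution is attained at `s = log (1 + a)`. -/
lemma le_freeQueue {b a : ℝ} (ha : 0 < a) (s : ℝ) : b - a + Real.log (1 + a) ≤ freeQueue b a s := by
  rw [freeQueue_eq b a s ha]
  linarith [Real.add_one_le_exp (Real.log (1 + a) - s)]

lemma lt_freeQueue {b a s : ℝ} (ha : 0 < a) (hs : s ≠ Real.log (1 + a)) :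
    b - a + Real.log (1 + a) < freeQueue b a s := by
  rw [freeQueue_eq b a s ha]
  linarith [Real.add_one_lt_exp (sub_ne_zero.2 hs.symm)]

lemma freeQueue_strictAntiOn {b a : ℝ} (ha : 0 < a) :
    StrictAntiOn (freeQueue b a) (Iic (Real.log (1 + a))) := by
  refine strictAntiOn_of_deriv_neg (convex_Iic _)
    (fun s _ => (hasDerivAt_freeQueue b a s).continuousAt.continuousWithinAt) fun s hs => ?_
  rw [interior_Iic, mem_Iio] at hs
  rw [(hasDerivAt_freeQueue b a s).deriv]
  have h1 : 1 < Real.exp (Real.log (1 + a) - s) := Real.one_lt_exp_iff.2 (by linarith)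
  rw [sub_eq_add_neg, Real.exp_add, Real.exp_log (by linarith)] at h1
  linarith

/-- The value of the free solution at the second candidate for the overflow time, compared with
`b`. -/
lemma freeQueue_fill_sub {b a : ℝ} (hb : 0 ≤ b) (ha : 0 < a) :
    freeQueue b a (a - b + fillTime b) - b =
      Real.exp (Real.log (1 + a) - (a - b + fillTime b)) - Real.exp (-fillTime b) := by
  have h1 := refill_fillTime hb
  rw [freeQueue_eq _ _ _ ha]
  unfold refill at h1
  linarith

/-- If the buffer does not run empty, or just touches `0`, then the overflow time is `freeTime`. -/
lemma overflowTime_eq_freeTime {b a : ℝ} (hb : 0 ≤ b) (ha : 0 < a)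
    (h : a - b ≤ Real.log (1 + a)) : overflowTime b a = freeTime a := by
  have hr := le_fillTime hb
  refine min_eq_left (not_lt.1 fun hlt => ?_)
  rw [← freeQueue_lt_iff (b := b) ha (by linarith), ← sub_neg, freeQueue_fill_sub hb ha, sub_neg,
    Real.exp_lt_exp] at hlt
  linarith

/-- If the buffer runs empty, then the overflow starts earlier than it would for the free solution,
which becomes negative in this case. -/
lemma lt_freeTime_of_empty {b a : ℝ} (hb : 0 ≤ b) (ha : 0 < a)
    (h : Real.log (1 + a) < a - b) : a - b + fillTime b < freeTime a := by
  have hr := le_fillTime hb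
  rw [← freeQueue_lt_iff (b := b) ha (by linarith), ← sub_neg, freeQueue_fill_sub hb ha, sub_neg,
    Real.exp_lt_exp]
  linarith

/-- The evolution of the queue during the time from a full buffer with `v = b + q - a`, `a > 0`, to
the reaction to the next overflow. -/
structure IsProfile (q b a : ℝ) (Y : ℝ → ℝ) : Prop where
  queue : IsQueue q b (fun s => b + q - a + s) Y 0 (overflowTime b a + 1)
  init : Y 0 = b
  lt : 0 < b → ∀ s ∈ Ioo 0 (overflowTime b a), Y s < b
  full : ∀ s ∈ Icc (overflowTime b a) (overflowTime b a + 1), Y s = b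

lemma isQueue_full {q b s t : ℝ} {v : ℝ → ℝ} (hb : 0 ≤ b) (hv : ∀ u ∈ Ico s t, q + b ≤ v u) :
    IsQueue q b v (fun _ => b) s t :=
  isQueue_of_hasDerivAt (fun u => hasDerivAt_const u b) (fun _ _ => ⟨hb, le_rfl⟩)
    fun u hu => queueRate_full (hv u hu)

lemma exists_isProfile_of_not_empty {q b a : ℝ} (hb : 0 ≤ b) (ha : 0 < a)
    (h : a - b ≤ Real.log (1 + a)) : ∃ Y, IsProfile q b a Y := by
  have hT := overflowTime_eq_freeTime hb ha h
  have hT0 := freeTime_pos ha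
  have hfree : IsQueue q b (fun s => b + q - a + s) (freeQueue b a) 0 (freeTime a) := by
    refine isQueue_of_hasDerivAt (hasDerivAt_freeQueue b a) (fun u hu => ⟨?_, ?_⟩) fun u hu => ?_
    · linarith [le_freeQueue (b := b) ha u]
    · rcases hu.1.eq_or_lt with rfl | h0
      · rw [freeQueue_zero]
      · exact (freeQueue_le_iff ha h0).2 hu.2
    · rw [queueRate_eq]
      · unfold freeQueue
        ring
      · -- the queue can vanish only at its minimum, and then `v ≥ q`
        intro h0
        by_contra hv
        have hne : u ≠ Real.log (1 + a) := by
          rintro rfl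
          linarith
        linarith [lt_freeQueue (b := b) ha hne]
      · intro hub
        rcases hu.1.eq_or_lt with rfl | h0
        · linarith
        · exact absurd hub ((freeQueue_lt_iff ha h0).2 hu.2).ne
  have hfull : IsQueue q b (fun s => b + q - a + s) (fun _ => b) (freeTime a) (freeTime a + 1) :=
    isQueue_full hb fun u hu => by linarith [hu.1, (freeTime_spec ha).1]
  refine ⟨fun u => if u < freeTime a then freeQueue b a u else b, ?_, ?_, ?_, ?_⟩
  · rw [hT]
    exact hfree.glue hfull hT0.le (by linarith) (freeQueue_freeTime ha)
  · rw [if_pos hT0, freeQueue_zero]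
  · intro _ s hs
    rw [hT] at hs
    rw [if_pos hs.2]
    exact (freeQueue_lt_iff ha hs.1).2 hs.2
  · intro s hs
    rw [hT] at hs
    exact if_neg (not_lt.2 hs.1)

lemma exists_isProfile_of_empty {q b a : ℝ} (hb : 0 ≤ b) (ha : 0 < a)
    (h : Real.log (1 + a) < a - b) : ∃ Y, IsProfile q b a Y := by
  have hT : overflowTime b a = a - b + fillTime b := min_eq_right (lt_freeTime_of_empty hb ha h).le
  have hr := le_fillTime hb
  have hr0 := fillTime_nonneg b
  have hlog : 0 < Real.log (1 + a) := Real.log_pos (by linarith)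
  have hanti := freeQueue_strictAntiOn (b := b) ha
  -- the moment when the buffer runs empty
  obtain ⟨e, he, he0⟩ : ∃ e ∈ Icc 0 (Real.log (1 + a)), freeQueue b a e = 0 := by
    have hc : ContinuousOn (freeQueue b a) (Icc 0 (Real.log (1 + a))) := fun s _ =>
      (hasDerivAt_freeQueue b a s).continuousAt.continuousWithinAt
    refine intermediate_value_Icc' hlog.le hc ⟨?_, ?_⟩
    · rw [freeQueue_eq _ _ _ ha, sub_self, Real.exp_zero]
      linarith
    · rwa [freeQueue_zero]
  have hfree : IsQueue q b (fun s => b + q - a + s) (freeQueue b a) 0 e := by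
    refine isQueue_of_hasDerivAt (hasDerivAt_freeQueue b a) (fun u hu => ⟨?_, ?_⟩) fun u hu => ?_
    · rw [← he0]
      exact hanti.antitoneOn (hu.2.trans he.2) he.2 hu.2
    · have := hanti.antitoneOn hlog.le (hu.2.trans he.2) hu.1
      rwa [freeQueue_zero] at this
    · have h1 : 0 < freeQueue b a u := by
        rw [← he0]
        exact hanti (hu.2.le.trans he.2) he.2 hu.2
      rw [queueRate_eq (fun h0 => absurd h0 h1.ne') fun _ => by linarith [hu.2, he.2]]
      unfold freeQueue
      ring
  have hempty : IsQueue q b (fun s => b + q - a + s) (fun _ => 0) e (a - b) :=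
    isQueue_of_hasDerivAt (fun u => hasDerivAt_const u 0) (fun _ _ => ⟨le_rfl, hb⟩)
      fun u hu => queueRate_empty (by linarith [hu.2])
  have hfill : IsQueue q b (fun s => b + q - a + s) (fun s => refill (s - (a - b))) (a - b)
      (a - b + fillTime b) := by
    refine isQueue_of_hasDerivAt
      (fun u => (hasDerivAt_refill (u - (a - b))).comp_sub_const u (a - b))
      (fun u hu => ⟨?_, ?_⟩) fun u hu => ?_
    · rw [← refill_zero]
      exact refill_strictMonoOn.monotoneOn self_mem_Ici (sub_nonneg.2 hu.1) (sub_nonneg.2 hu.1)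
    · have : refill (u - (a - b)) ≤ refill (fillTime b) :=
        refill_strictMonoOn.monotoneOn (sub_nonneg.2 hu.1) hr0 (by linarith [hu.2])
      rwa [refill_fillTime hb] at this
    · have hlt : refill (u - (a - b)) < refill (fillTime b) :=
        refill_strictMonoOn (sub_nonneg.2 hu.1) hr0 (by linarith [hu.2])
      rw [refill_fillTime hb] at hlt
      rw [queueRate_eq (fun _ => by linarith [hu.1]) fun hub => absurd hub hlt.ne]
      unfold refill
      ring
  have hfull : IsQueue q b (fun s => b + q - a + s) (fun _ => b) (a - b + fillTime b)
      (a - b + fillTime b + 1) :=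
    isQueue_full hb fun u hu => by linarith [hu.1]
  have h1 := hfill.glue hfull (by linarith) (by linarith)
    (by rw [add_sub_cancel_left, refill_fillTime hb])
  have h2 := hempty.glue h1 (by linarith [he.2]) (by linarith) (by
    split_ifs with h0
    · rw [sub_self, refill_zero]
    · rw [← refill_zero, ← refill_fillTime hb]
      congr 1
      linarith)
  have h3 := hfree.glue h2 he.1 (by linarith [he.2]) (by
    split_ifs with h4 h5
    · exact he0
    · rw [he0, show e = a - b by linarith [he.2], sub_self, refill_zero]
    · rw [he0, ← refill_zero, ← refill_fillTime hb]
      congr 1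
      linarith [he.2])
  refine ⟨_, hT ▸ h3, ?_, ?_, ?_⟩
  · split_ifs with h4 h5 h6
    · exact freeQueue_zero b a
    · have : e = 0 := le_antisymm (not_lt.1 h4) he.1
      rw [← he0, this, freeQueue_zero]
    · linarith [he.2]
    · rfl
  · intro hb' s hs
    rw [hT] at hs
    split_ifs with h4 h5 h6
    · have := hanti hlog.le (h4.le.trans he.2) hs.1
      rwa [freeQueue_zero] at this
    · exact hb'
    · have := refill_strictMonoOn (sub_nonneg.2 (not_lt.1 h5)) hr0
        (show s - (a - b) < fillTime b by linarith [hs.2])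
      rwa [refill_fillTime hb] at this
    · exact absurd hs.2 (hT ▸ h6)
  · intro s hs
    rw [hT] at hs
    rw [if_neg (by linarith [hs.1, he.2]), if_neg (by linarith [hs.1]), if_neg (by linarith [hs.1])]

lemma exists_isProfile (q : ℝ) {b a : ℝ} (hb : 0 ≤ b) (ha : 0 < a) : ∃ Y, IsProfile q b a Y :=
  (le_or_gt (a - b) (Real.log (1 + a))).elim (exists_isProfile_of_not_empty hb ha)
    (exists_isProfile_of_empty hb ha)

/-- A full buffer with `v ≥ b + q` does not occur before the overflow time. -/
lemma IsProfile.overflowTime_le {q b a s : ℝ} {Y : ℝ → ℝ} (hY : IsProfile q b a Y) (hb : 0 ≤ b)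
    (ha : 0 < a) (hs : Y s = b) (has : a ≤ s) : overflowTime b a ≤ s := by
  rcases hb.eq_or_lt with rfl | hb'
  · linarith [excess_zero ha, show excess 0 a = overflowTime 0 a - a from rfl]
  · by_contra hlt
    exact (hY.lt hb' s ⟨by linarith, not_le.1 hlt⟩).ne hs

/-! ### Trajectories up to the first jump -/

lemma IsTrajectory.isQueue {β q b S : ℝ} {v y : ℝ → ℝ} (h : IsTrajectory β q b v y S) :
    IsQueue q b v y 0 S :=
  ⟨h.cont_y, h.mem_y, h.deriv_y⟩

/-- In the absence of jumps, `v` grows at unit rate. -/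
lemma IsTrajectory.v_eq {β q b S : ℝ} {v y : ℝ → ℝ} (h : IsTrajectory β q b v y S) {t : ℝ}
    (ht : t ≤ S) (hj : ∀ u ∈ Ioc 0 t, ¬ JumpTime q b v y u) {s : ℝ} (hs : s ∈ Icc 0 t) :
    v s = v 0 + s := by
  have hc : ContinuousOn v (Icc 0 t) := by
    intro s hs
    rcases hs.1.eq_or_lt with rfl | h0
    · rcases hs.2.eq_or_lt with rfl | h1
      · simp
      · exact (h.deriv_v 0 ⟨le_rfl, h1.trans_le ht⟩).continuousWithinAt.mono Icc_subset_Ici_self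
    · have hl : ContinuousWithinAt v (Iic s) s :=
        continuousWithinAt_Iio_iff_Iic.1 (h.cont_v s ⟨h0, hs.2.trans ht⟩ (hj s ⟨h0, hs.2⟩))
      rcases hs.2.eq_or_lt with rfl | h1
      · exact hl.mono Icc_subset_Iic_self
      · have hr := (h.deriv_v s ⟨hs.1, h1.trans_le ht⟩).continuousWithinAt
        have := hl.union hr
        rw [Iic_union_Ici] at this
        exact this.mono (subset_univ _)
  have := constant_of_has_deriv_right_zero (f := fun s => v s - s) (hc.sub continuousOn_id)
    (fun u hu => by
      have := (h.deriv_v u ⟨hu.1, hu.2.trans_le ht⟩).fun_sub (hasDerivWithinAt_id u _)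
      rwa [sub_self] at this) s hs
  simp only [sub_zero] at this
  linarith

lemma IsTrajectory.y_eq {β q b S : ℝ} {v y Y : ℝ → ℝ} (h : IsTrajectory β q b v y S)
    (hY : IsProfile q b (b + q - v 0) Y) {t : ℝ} (ht : t ≤ S)
    (htT : t ≤ overflowTime b (b + q - v 0) + 1) (hv : ∀ s ∈ Ico 0 t, v s = v 0 + s) :
    EqOn y Y (Icc 0 t) := by
  refine (h.isQueue.mono ht).eqOn ((hY.queue.mono htT).congr fun u hu => ?_) ?_
  · rw [hv u hu]
    ring
  · rw [h.init_y, hY.init]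

/-- There is no jump before the reaction to the first overflow.  The proof advances by unit steps,
because a jump at time `u` refers to the state at time `u - 1`. -/
lemma IsTrajectory.not_jumpTime {β q b S : ℝ} {v y Y : ℝ → ℝ} (h : IsTrajectory β q b v y S)
    (hb : 0 ≤ b) (hY : IsProfile q b (b + q - v 0) Y) (n : ℕ) {t : ℝ} (htn : t ≤ n) (htS : t ≤ S)
    (htT : t < overflowTime b (b + q - v 0) + 1) : ∀ u ∈ Ioc 0 t, ¬ JumpTime q b v y u := by
  have ha : 0 < b + q - v 0 := by linarith [h.init_v]
  induction n generalizing t with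
  | zero =>
    intro u hu
    rw [Nat.cast_zero] at htn
    linarith [hu.1, hu.2]
  | succ n ih =>
    rintro u hu ⟨hu0, ⟨hy, hv⟩, -⟩
    rw [Nat.cast_add, Nat.cast_one] at htn
    have hn := ih (t := u - 1) (by linarith [hu.2]) (by linarith [hu.2]) (by linarith [hu.2])
    have hveq := fun s hs => h.v_eq (by linarith [hu.2]) hn (s := s) hs
    have hyeq := h.y_eq hY (t := u - 1) (by linarith [hu.2]) (by linarith [hu.2])
      fun s hs => hveq s (Ico_subset_Icc_self hs)
    have hmem : u - 1 ∈ Icc 0 (u - 1) := ⟨hu0, le_rfl⟩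
    rw [hyeq hmem] at hy
    rw [hveq _ hmem] at hv
    linarith [hY.overflowTime_le hb ha hy (by linarith), hu.2]

lemma IsTrajectory.not_jumpTime_of_lt {β q b S : ℝ} {v y Y : ℝ → ℝ}
    (h : IsTrajectory β q b v y S) (hb : 0 ≤ b) (hY : IsProfile q b (b + q - v 0) Y) {t : ℝ}
    (htS : t ≤ S) (htT : t < overflowTime b (b + q - v 0) + 1) :
    ∀ u ∈ Ioc 0 t, ¬ JumpTime q b v y u :=
  h.not_jumpTime hb hY ⌈t⌉₊ (Nat.le_ceil t) htS htT

lemma IsTrajectory.v_eq_of_lt {β q b S : ℝ} {v y Y : ℝ → ℝ}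
    (h : IsTrajectory β q b v y S) (hb : 0 ≤ b) (hY : IsProfile q b (b + q - v 0) Y) {s : ℝ}
    (hs0 : 0 ≤ s) (hsS : s ≤ S) (hsT : s < overflowTime b (b + q - v 0) + 1) : v s = v 0 + s :=
  h.v_eq hsS (h.not_jumpTime_of_lt hb hY hsS hsT) ⟨hs0, le_rfl⟩

lemma IsTrajectory.y_eq_of_le {β q b S : ℝ} {v y Y : ℝ → ℝ}
    (h : IsTrajectory β q b v y S) (hb : 0 ≤ b) (hY : IsProfile q b (b + q - v 0) Y) {s : ℝ}
    (hs0 : 0 ≤ s) (hsS : s ≤ S) (hsT : s ≤ overflowTime b (b + q - v 0) + 1) : y s = Y s :=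
  h.y_eq hY hsS hsT (fun _ hu => h.v_eq_of_lt hb hY hu.1 (hu.2.le.trans hsS) (hu.2.trans_le hsT))
    ⟨hs0, le_rfl⟩

lemma IsTrajectory.full_of_mem {β q b S : ℝ} {v y Y : ℝ → ℝ}
    (h : IsTrajectory β q b v y S) (hb : 0 ≤ b) (hY : IsProfile q b (b + q - v 0) Y) {s : ℝ}
    (hsS : s ≤ S)
    (hs : s ∈ Ico (overflowTime b (b + q - v 0)) (overflowTime b (b + q - v 0) + 1)) :
    Full q b v y s := by
  have ha : 0 < b + q - v 0 := by linarith [h.init_v]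
  have h0 := overflowTime_pos hb ha
  have hs0 : 0 ≤ s := h0.le.trans hs.1
  refine ⟨?_, ?_⟩
  · rw [h.y_eq_of_le hb hY hs0 hsS hs.2.le, hY.full s (Ico_subset_Icc_self hs)]
  · rw [h.v_eq_of_lt hb hY hs0 hsS hs.2]
    linarith [le_overflowTime hb ha, hs.1]

lemma IsTrajectory.jumpTime {β q b S : ℝ} {v y Y : ℝ → ℝ}
    (h : IsTrajectory β q b v y S) (hb : 0 ≤ b) (hY : IsProfile q b (b + q - v 0) Y)
    (hS : overflowTime b (b + q - v 0) + 1 ≤ S) :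
    JumpTime q b v y (overflowTime b (b + q - v 0) + 1) := by
  have ha : 0 < b + q - v 0 := by linarith [h.init_v]
  have h0 := overflowTime_pos hb ha
  unfold JumpTime
  rw [add_sub_cancel_right]
  refine ⟨h0.le, h.full_of_mem hb hY (by linarith) ⟨le_rfl, by linarith⟩, ?_⟩
  filter_upwards [Ioo_mem_nhdsLT h0] with u hu hfull
  obtain ⟨hy, hv⟩ := hfull
  rw [h.y_eq_of_le hb hY hu.1.le (by linarith [hu.2]) (by linarith [hu.2])] at hy
  rw [h.v_eq_of_lt hb hY hu.1.le (by linarith [hu.2]) (by linarith [hu.2])] at hv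
  linarith [hY.overflowTime_le hb ha hy (by linarith), hu.2]

lemma IsTrajectory.jumpOfOrder {β q b S : ℝ} {v y Y : ℝ → ℝ}
    (h : IsTrajectory β q b v y S) (hb : 0 ≤ b) (hY : IsProfile q b (b + q - v 0) Y)
    (hS : overflowTime b (b + q - v 0) + 1 ≤ S) {k : ℕ}
    (hk : JumpOfOrder β q b v (overflowTime b (b + q - v 0) + 1) k) :
    IsLeast {i : ℕ | β ^ i * (v 0 + (overflowTime b (b + q - v 0) + 1)) < b + q} k ∧
      v (overflowTime b (b + q - v 0) + 1) =
        β ^ k * (v 0 + (overflowTime b (b + q - v 0) + 1)) := by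
  have ha : 0 < b + q - v 0 := by linarith [h.init_v]
  have h0 := overflowTime_pos hb ha
  obtain ⟨vl, hvl, hk, hv⟩ := hk
  have hlim : Tendsto v (𝓝[<] (overflowTime b (b + q - v 0) + 1))
      (𝓝 (v 0 + (overflowTime b (b + q - v 0) + 1))) := by
    have hc : Tendsto (fun s => v 0 + s) (𝓝[<] (overflowTime b (b + q - v 0) + 1))
        (𝓝 (v 0 + (overflowTime b (b + q - v 0) + 1))) :=
      ((continuous_const.add continuous_id).tendsto _).mono_left nhdsWithin_le_nhds
    refine hc.congr' ?_
    filter_upwards [Ioo_mem_nhdsLT (show (0 : ℝ) < overflowTime b (b + q - v 0) + 1 by linarith)]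
      with u hu
    exact (h.v_eq_of_lt hb hY hu.1.le (hu.2.le.trans hS) hu.2).symm
  obtain rfl := tendsto_nhds_unique hvl hlim
  exact ⟨hk, hv⟩

lemma IsTrajectory.exists_jump {β q b S : ℝ} {v y Y : ℝ → ℝ}
    (h : IsTrajectory β q b v y S) (hb : 0 ≤ b) (hY : IsProfile q b (b + q - v 0) Y)
    (hS : overflowTime b (b + q - v 0) + 1 ≤ S) :
    ∃ k, IsLeast {i : ℕ | β ^ i * (v 0 + (overflowTime b (b + q - v 0) + 1)) < b + q} k ∧
      v (overflowTime b (b + q - v 0) + 1) =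
        β ^ k * (v 0 + (overflowTime b (b + q - v 0) + 1)) := by
  have ha : 0 < b + q - v 0 := by linarith [h.init_v]
  have h0 := overflowTime_pos hb ha
  obtain ⟨k, hk⟩ := h.jump_v _ ⟨by linarith, hS⟩ (h.jumpTime hb hY hS)
  exact ⟨k, h.jumpOfOrder hb hY hS hk⟩

lemma IsTrajectory.y_jump {β q b S : ℝ} {v y Y : ℝ → ℝ}
    (h : IsTrajectory β q b v y S) (hb : 0 ≤ b) (hY : IsProfile q b (b + q - v 0) Y)
    (hS : overflowTime b (b + q - v 0) + 1 ≤ S) : y (overflowTime b (b + q - v 0) + 1) = b := by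
  have ha : 0 < b + q - v 0 := by linarith [h.init_v]
  have h0 := overflowTime_pos hb ha
  rw [h.y_eq_of_le hb hY (by linarith) hS le_rfl]
  exact hY.full _ ⟨by linarith, le_rfl⟩

/-! ### Restarting a trajectory after a jump -/

lemma hasDerivWithinAt_Ici_comp_const_add {f : ℝ → ℝ} {f' t s : ℝ}
    (h : HasDerivWithinAt f f' (Ici (t + s)) (t + s)) :
    HasDerivWithinAt (fun x => f (t + x)) f' (Ici s) s := by
  have := h.scomp s ((hasDerivWithinAt_id s (Ici s)).const_add t)
    (fun x hx => add_le_add_right (mem_Ici.1 hx) t)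
  rwa [one_smul] at this

lemma tendsto_comp_add_nhdsLT {f : ℝ → ℝ} {t s : ℝ} {l : Filter ℝ} :
    Tendsto (fun x => f (t + x)) (𝓝[<] s) l ↔ Tendsto f (𝓝[<] (t + s)) l := by
  rw [← map_add_left_nhdsLT, tendsto_map'_iff]
  rfl

lemma eventually_comp_add_nhdsLT {p : ℝ → Prop} {t s : ℝ} :
    (∀ᶠ x in 𝓝[<] s, p (t + x)) ↔ ∀ᶠ x in 𝓝[<] (t + s), p x := by
  rw [← map_add_left_nhdsLT, eventually_map]

lemma jumpTime_shift_iff {q b t s : ℝ} {v y : ℝ → ℝ}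
    (hfull : ∀ u ∈ Ico (t - 1) t, Full q b v y u) (ht : 1 ≤ t) (hs : 0 < s) :
    JumpTime q b (fun x => v (t + x)) (fun x => y (t + x)) s ↔ JumpTime q b v y (t + s) := by
  have hF : ∀ u, Full q b (fun x => v (t + x)) (fun x => y (t + x)) u ↔ Full q b v y (t + u) :=
    fun u => Iff.rfl
  unfold JumpTime OverflowStart
  simp only [hF]
  rw [eventually_comp_add_nhdsLT (p := fun u => ¬ Full q b v y u), add_sub_assoc]
  refine and_congr_left fun ⟨hf, hl⟩ => ⟨fun h => by linarith, fun _ => ?_⟩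
  -- no overflow starts in `(t - 1, t)`, since the buffer overflows all the time there
  by_contra hlt
  rw [not_le] at hlt
  have hmem := Ioo_mem_nhdsLT (show t - 1 < t + (s - 1) by linarith)
  obtain ⟨u, hu, hu'⟩ := (hl.and hmem).exists
  exact hu (hfull u ⟨hu'.1.le, by linarith [hu'.2]⟩)

/-- A trajectory can be restarted at a time `t` when the buffer is full, `v < b + q`, and no jump is
pending: the latter holds because the buffer has overflowed during the whole interval
`[t - 1, t)`. -/
lemma IsTrajectory.shift {β q b S : ℝ} {v y : ℝ → ℝ} (h : IsTrajectory β q b v y S) {t : ℝ}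
    (ht : 1 ≤ t) (hvt : v t < b + q) (hyt : y t = b)
    (hfull : ∀ u ∈ Ico (t - 1) t, Full q b v y u) :
    IsTrajectory β q b (fun x => v (t + x)) (fun x => y (t + x)) (S - t) where
  init_y := by simpa using hyt
  init_v := by simpa using hvt
  mem_y s hs := h.mem_y _ ⟨by linarith [hs.1], by linarith [hs.2]⟩
  cont_y := h.cont_y.comp (continuous_const.add continuous_id').continuousOn
    fun s hs => ⟨by linarith [hs.1], by linarith [hs.2]⟩
  deriv_v s hs := hasDerivWithinAt_Ici_comp_const_add
    (h.deriv_v _ ⟨by linarith [hs.1], by linarith [hs.2]⟩)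
  deriv_y s hs := hasDerivWithinAt_Ici_comp_const_add
    (h.deriv_y _ ⟨by linarith [hs.1], by linarith [hs.2]⟩)
  cont_v s hs hj := by
    rw [jumpTime_shift_iff hfull ht hs.1] at hj
    exact tendsto_comp_add_nhdsLT.2
      (h.cont_v _ ⟨by linarith [hs.1], by linarith [hs.2]⟩ hj)
  jump_v s hs hj := by
    rw [jumpTime_shift_iff hfull ht hs.1] at hj
    obtain ⟨k, vl, hvl, hk⟩ := h.jump_v _ ⟨by linarith [hs.1], by linarith [hs.2]⟩ hj
    exact ⟨k, vl, tendsto_comp_add_nhdsLT.2 hvl, hk⟩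

/-- After the reaction to the first overflow, the trajectory starts anew. -/
lemma IsTrajectory.restart {β q b S : ℝ} {v y Y : ℝ → ℝ}
    (h : IsTrajectory β q b v y S) (hb : 0 ≤ b) (hY : IsProfile q b (b + q - v 0) Y)
    (hS : overflowTime b (b + q - v 0) + 1 ≤ S) :
    IsTrajectory β q b (fun x => v (overflowTime b (b + q - v 0) + 1 + x))
      (fun x => y (overflowTime b (b + q - v 0) + 1 + x))
      (S - (overflowTime b (b + q - v 0) + 1)) := by
  have ha : 0 < b + q - v 0 := by linarith [h.init_v]
  have h0 := overflowTime_pos hb ha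
  obtain ⟨k, hk, hv⟩ := h.exists_jump hb hY hS
  refine h.shift (by linarith) ?_ (h.y_jump hb hY hS) fun u hu => ?_
  · rw [hv]
    exact hk.1
  · rw [add_sub_cancel_right] at hu
    exact h.full_of_mem hb hY (hu.2.le.trans hS) hu

/-! ### The return map -/

/-- The value of `v` just before the reaction to the next overflow, if the buffer is full at the
start and `v` starts from `x < b + q`. -/
def peak (q b x : ℝ) : ℝ := b + q + 1 + excess b (b + q - x)

lemma add_overflowTime_eq_peak (q b x : ℝ) :
    x + (overflowTime b (b + q - x) + 1) = peak q b x := by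
  unfold peak excess
  ring

lemma le_peak {q b x : ℝ} (hb : 0 ≤ b) (hx : x < b + q) : b + q + 1 ≤ peak q b x :=
  le_add_of_nonneg_right (excess_nonneg hb (sub_pos.2 hx))

lemma peak_le {q b x : ℝ} (hx : x < b + q) : peak q b x ≤ b + q + 2 := by
  unfold peak
  linarith [excess_le_one (b := b) (sub_pos.2 hx)]

lemma peak_zero {q x : ℝ} (hx : x < q) : peak q 0 x = q + 1 := by
  unfold peak
  rw [excess_zero (by linarith)]
  ring

lemma peak_anti {q b x x' : ℝ} (hx' : x' < b + q) (h : x ≤ x') : peak q b x' ≤ peak q b x := by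
  unfold peak
  linarith [excess_mono (b := b) (sub_pos.2 hx') (sub_le_sub_left h (b + q))]

lemma abs_peak_sub_le {q b x x' : ℝ} (hx : x < b + q) (hx' : x' < b + q) :
    |peak q b x - peak q b x'| ≤ |x - x'| := by
  unfold peak
  have := abs_excess_sub_le (b := b) (sub_pos.2 hx) (sub_pos.2 hx')
  rwa [sub_sub_sub_cancel_left, abs_sub_comm x', ← add_sub_add_left_eq_sub _ _ (b + q + 1)] at this

lemma continuousOn_peak (q b : ℝ) : ContinuousOn (peak q b) (Iio (b + q)) :=
  continuousOn_const.add ((continuousOn_excess b).comp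
    (continuous_const.sub continuous_id').continuousOn fun _ hx => mem_Ioi.2 (sub_pos.2 hx))

/-- A fixed point of `x ↦ β ^ k * peak q b x`, located between a point that is mapped to the right
and a point that is mapped to the left. -/
lemma exists_fixedPoint {β q b c d : ℝ} (k : ℕ) (hcd : c ≤ d) (hd : d < b + q)
    (hc : c ≤ β ^ k * peak q b c) (hd' : β ^ k * peak q b d ≤ d) :
    ∃ x ∈ Icc c d, β ^ k * peak q b x = x := by
  have hcont : ContinuousOn (fun x => x - β ^ k * peak q b x) (Icc c d) :=
    continuousOn_id.sub (continuousOn_const.mul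
      ((continuousOn_peak q b).mono fun x hx => hx.2.trans_lt hd))
  obtain ⟨x, hx, h0⟩ := intermediate_value_Icc hcd hcont
    (show (0 : ℝ) ∈ _ from ⟨sub_nonpos.2 hc, sub_nonneg.2 hd'⟩)
  exact ⟨x, hx, (sub_eq_zero.1 h0).symm⟩

/-- The criterion for uniqueness: after a jump to the lowest possible level `β (b + q)`, a single
reduction suffices at the next jump. -/
def SingleReduction (β q b : ℝ) : Prop := β * peak q b (β * (b + q)) < b + q

/-- The smallest sufficient number of reductions leads to a value of at least `β A`. -/
lemma mul_le_of_isLeast {β A W : ℝ} {k : ℕ} (hβ : 0 ≤ β) (hW : A ≤ W)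
    (hk : IsLeast {i : ℕ | β ^ i * W < A} k) : β * A ≤ β ^ k * W := by
  have hk1 := hk.1
  cases k with
  | zero => simp only [mem_ofPred_eq, pow_zero, one_mul] at hk1; linarith
  | succ j =>
    have hj : ¬ β ^ j * W < A := fun h => by
      have := hk.2 h
      omega
    rw [pow_succ', mul_assoc]
    exact mul_le_mul_of_nonneg_left (not_lt.1 hj) hβ

lemma eq_one_of_isLeast {β A W : ℝ} {k : ℕ} (hW : A ≤ W) (h1 : β * W < A)
    (hk : IsLeast {i : ℕ | β ^ i * W < A} k) : k = 1 := by
  have hk1 := hk.1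
  have hle : k ≤ 1 := hk.2 (by simpa using h1)
  have hne : k ≠ 0 := by
    rintro rfl
    simp only [mem_ofPred_eq, pow_zero, one_mul] at hk1
    linarith
  omega

/-! ### Construction of cycles -/

/-- A fixed point of the return map gives a cycle. -/
lemma exists_cycle {β q b x : ℝ} {k : ℕ} (hb : 0 ≤ b) (hx : x < b + q)
    (hk : IsLeast {i : ℕ | β ^ i * peak q b x < b + q} k) (hfix : β ^ k * peak q b x = x) :
    ∃ (v y : ℝ → ℝ) (S : ℝ), IsCycleOfOrder β q b v y S k ∧ v 0 = x ∧
      (0 < b → ∀ s ∈ Ico 0 S, y s = b → v s < b + q → s = 0) := by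
  have ha : 0 < b + q - x := sub_pos.2 hx
  obtain ⟨Y, hY⟩ := exists_isProfile q hb ha
  have hT0 := overflowTime_pos hb ha
  have haT := le_overflowTime hb ha
  have hpeak := add_overflowTime_eq_peak q b x
  set T := overflowTime b (b + q - x) with hT
  let v : ℝ → ℝ := fun s => if s < T + 1 then x + s else x + (s - (T + 1))
  have hv : ∀ s, s < T + 1 → v s = x + s := fun s hs => if_pos hs
  have hvT : v (T + 1) = x := by simp [v]
  have hv0 : v 0 = x := by rw [hv 0 (by linarith), add_zero]
  have hleft : ∀ s ≤ T + 1, Tendsto v (𝓝[<] s) (𝓝 (x + s)) := by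
    intro s hs
    have hc : Tendsto (fun s => x + s) (𝓝[<] s) (𝓝 (x + s)) :=
      ((continuous_const.add continuous_id).tendsto _).mono_left nhdsWithin_le_nhds
    refine hc.congr' ?_
    filter_upwards [self_mem_nhdsWithin] with u hu
    exact (hv u (lt_of_lt_of_le hu hs)).symm
  have hjump : ∀ u ∈ Ioc 0 (T + 1), JumpTime q b v Y u ↔ u = T + 1 := by
    intro u hu
    constructor
    · rintro ⟨hu0, ⟨hy, hvu⟩, -⟩
      rw [hv _ (by linarith [hu.2])] at hvu
      linarith [hY.overflowTime_le hb ha hy (by linarith), hu.2]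
    · rintro rfl
      unfold JumpTime
      rw [add_sub_cancel_right]
      refine ⟨hT0.le, ⟨hY.full T ⟨le_rfl, by linarith⟩, ?_⟩, ?_⟩
      · rw [hv T (by linarith)]
        linarith
      · filter_upwards [Ioo_mem_nhdsLT hT0] with s hs hfull
        obtain ⟨hy, hvs⟩ := hfull
        rw [hv s (by linarith [hs.2])] at hvs
        linarith [hY.overflowTime_le hb ha hy (by linarith), hs.2]
  have hord : JumpOfOrder β q b v (T + 1) k := by
    refine ⟨x + (T + 1), hleft _ le_rfl, ?_, ?_⟩
    · rwa [hpeak]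
    · rw [hvT, hpeak, hfix]
  have htraj : IsTrajectory β q b v Y (T + 1) := by
    refine ⟨hY.init, by rwa [hv0], hY.queue.mem, hY.queue.cont, fun s hs => ?_, fun s hs => ?_,
      fun s hs hj => ?_, fun s hs hj => ?_⟩
    · refine ((hasDerivWithinAt_id s (Ici s)).const_add x).congr_of_eventuallyEq ?_ (hv s hs.2)
      filter_upwards [mem_nhdsWithin_of_mem_nhds (Iio_mem_nhds hs.2)] with u hu
      exact hv u hu
    · have := hY.queue.deriv s hs
      rwa [show b + q - (b + q - x) + s = v s by rw [hv s hs.2]; ring] at this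
    · have hlt : s < T + 1 := lt_of_le_of_ne hs.2 fun h => hj ((hjump s hs).2 h)
      rw [hv s hlt]
      exact hleft s hs.2
    · rw [(hjump s hs).1 hj]
      exact ⟨k, hord⟩
  refine ⟨v, Y, T + 1, ⟨⟨htraj, by linarith, ⟨by linarith, ?_, ?_⟩, ?_⟩, T + 1,
    ⟨by linarith, le_rfl⟩, hjump, hord⟩, hv0, ?_⟩
  · rw [hvT, hv0]
  · rw [hY.full _ ⟨by linarith, le_rfl⟩, hY.init]
  · rintro s ⟨hs0, hs, -⟩
    by_contra hlt
    rw [not_le] at hlt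
    rw [hv s hlt, hv0] at hs
    linarith
  · intro hb' s hs hys hvs
    rw [hv s hs.2] at hvs
    by_contra h0
    have hs0 : 0 < s := lt_of_le_of_ne hs.1 (Ne.symm h0)
    exact (hY.lt hb' s ⟨hs0, by linarith⟩).ne hys

/-! ### Cycles of order one force the criterion -/

/-- A cycle lasts at least until the first jump, since `v` does not return to its initial value
earlier. -/
lemma IsCycle.overflowTime_le {β q b S : ℝ} {v y : ℝ → ℝ} (hb : 0 ≤ b)
    (h : IsCycle β q b v y S) : overflowTime b (b + q - v 0) + 1 ≤ S := by
  obtain ⟨Y, hY⟩ := exists_isProfile q hb (sub_pos.2 h.traj.init_v)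
  by_contra hlt
  have h1 := h.one_le
  have h2 := h.traj.v_eq_of_lt hb hY (by linarith) le_rfl (not_le.1 hlt)
  have h3 := h.first_return.1.2.1
  linarith

lemma IsCycleOfOrder.mul_peak_lt {β q b S : ℝ} {v y : ℝ → ℝ} (hb : 0 ≤ b)
    (h : IsCycleOfOrder β q b v y S 1) : β * peak q b (v 0) < b + q := by
  obtain ⟨hc, s, hs, hj, hord⟩ := h
  have ha := sub_pos.2 hc.traj.init_v
  obtain ⟨Y, hY⟩ := exists_isProfile q hb ha
  have hS := hc.overflowTime_le hb
  have h0 := overflowTime_pos hb ha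
  rw [← (hj _ ⟨by linarith, hS⟩).1 (hc.traj.jumpTime hb hY hS)] at hord
  have := (hc.traj.jumpOfOrder hb hY hS hord).1.1
  rw [add_overflowTime_eq_peak] at this
  simpa using this

/-- If the criterion fails while a cycle of order `1` exists, then there is also a cycle of order
`2`, and it traces out a different curve. -/
lemma OnlySingleCycleOfOrderOne.singleReduction {β q b : ℝ} (hβ0 : 0 < β) (hβ1 : β < 1)
    (hq : 0 < q) (hb : 0 ≤ b) (h : OnlySingleCycleOfOrderOne β q b) : SingleReduction β q b := by
  obtain ⟨v, y, S, hc, huniq⟩ := h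
  have h1 := hc.mul_peak_lt hb
  have hv0 := hc.1.traj.init_v
  have hA : 0 < b + q := by linarith
  have hβA : β * (b + q) < b + q := by nlinarith
  have hp := le_peak hb hv0
  have h2 : β * (b + q + 1) < b + q := by nlinarith
  by_contra hnot
  unfold SingleReduction at hnot
  rw [not_lt] at hnot
  rcases hb.eq_or_lt with rfl | hb'
  · rw [zero_add] at hβA hnot h2
    rw [peak_zero hβA] at hnot
    linarith
  · have hd : β ^ 2 * (b + q + 2) < b + q := by nlinarith
    have hmid : β * (b + q) ≤ β ^ 2 * peak q b (β * (b + q)) := by nlinarith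
    have hcd : β * (b + q) ≤ β ^ 2 * (b + q + 2) :=
      hmid.trans (mul_le_mul_of_nonneg_left (peak_le hβA) (by positivity))
    obtain ⟨x, hx, hfix⟩ := exists_fixedPoint 2 hcd hd hmid
      (mul_le_mul_of_nonneg_left (peak_le hd) (by positivity))
    have hxA : x < b + q := hx.2.trans_lt hd
    have hbig : b + q ≤ β * peak q b x := by
      refine le_of_mul_le_mul_left ?_ hβ0
      calc β * (b + q) ≤ x := hx.1
        _ = β * (β * peak q b x) := by rw [← mul_assoc, ← sq, hfix]
    have hleast : IsLeast {i : ℕ | β ^ i * peak q b x < b + q} 2 := by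
      refine ⟨by rw [mem_ofPred_eq, hfix]; exact hxA, fun i hi => ?_⟩
      by_contra hlt
      have : i = 0 ∨ i = 1 := by omega
      rcases this with rfl | rfl
      · simp only [mem_ofPred_eq, pow_zero, one_mul] at hi
        linarith [le_peak hb hxA]
      · simp only [mem_ofPred_eq, pow_one] at hi
        linarith
    obtain ⟨v', y', S', hc', hv', hret⟩ := exists_cycle hb hxA hleast hfix
    have hmem : (v 0, y 0) ∈ orbit v y S := ⟨0, ⟨le_rfl, by linarith [hc.1.one_le]⟩, rfl⟩
    rw [← huniq v' y' S' hc'.1] at hmem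
    obtain ⟨s, hs, hsv⟩ := hmem
    rw [Prod.mk.injEq, hc.1.traj.init_y] at hsv
    have hs0 := hret hb' s hs hsv.2 (by rwa [hsv.1])
    rw [hs0, hv'] at hsv
    rw [← hsv.1] at h1
    linarith

/-! ### Uniqueness under the criterion -/

/-- Under the criterion, each return to a full buffer below `b + q` brings the state closer to the
fixed point `x` by the factor `β`, as soon as `v ≥ β (b + q)`, which holds after the first jump. -/
lemma IsTrajectory.contraction {β q b x : ℝ} (hβ0 : 0 < β) (hβ1 : β < 1) (hb : 0 < b)
    (hsr : SingleReduction β q b) (hx : x < b + q) (hfix : β * peak q b x = x) (n : ℕ) :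
    ∀ {v y : ℝ → ℝ} {S : ℝ}, IsTrajectory β q b v y S → S < n → 0 < S → y S = b →
      v S < b + q → β * (b + q) ≤ v S ∧ (β * (b + q) ≤ v 0 → |v S - x| ≤ β * |v 0 - x|) := by
  induction n with
  | zero =>
    intro v y S _ hS hS0
    rw [Nat.cast_zero] at hS
    linarith
  | succ n ih =>
    intro v y S h hSn hS0 hyS hvS
    rw [Nat.cast_add, Nat.cast_one] at hSn
    have hv0 := h.init_v
    have ha := sub_pos.2 hv0
    obtain ⟨Y, hY⟩ := exists_isProfile q hb.le ha
    have hT0 := overflowTime_pos hb.le ha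
    have hS : overflowTime b (b + q - v 0) + 1 ≤ S := by
      by_contra hlt
      rw [not_le] at hlt
      rcases lt_or_ge S (overflowTime b (b + q - v 0)) with hST | hST
      · have := hY.lt hb S ⟨hS0, hST⟩
        rw [← h.y_eq_of_le hb.le hY hS0.le le_rfl hlt.le] at this
        linarith
      · have := (h.full_of_mem hb.le hY le_rfl ⟨hST, hlt⟩).2
        linarith
    obtain ⟨k, hk, hv⟩ := h.exists_jump hb.le hY hS
    have hr := h.restart hb.le hY hS
    have hpk := le_peak hb.le hv0
    rw [add_overflowTime_eq_peak] at hk hv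
    set T := overflowTime b (b + q - v 0)
    have hlow : β * (b + q) ≤ v (T + 1) := by
      rw [hv]
      exact mul_le_of_isLeast hβ0.le (by linarith) hk
    have hcon : β * (b + q) ≤ v 0 → |v (T + 1) - x| ≤ β * |v 0 - x| := by
      intro hlow0
      have h1 : β * peak q b (v 0) < b + q :=
        (mul_le_mul_of_nonneg_left (peak_anti hv0 hlow0) hβ0.le).trans_lt hsr
      rw [hv, eq_one_of_isLeast (by linarith) h1 hk, pow_one]
      calc |β * peak q b (v 0) - x| = β * |peak q b (v 0) - peak q b x| := by
            rw [← abs_of_pos hβ0, ← abs_mul, abs_of_pos hβ0, mul_sub, hfix]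
        _ ≤ β * |v 0 - x| := mul_le_mul_of_nonneg_left (abs_peak_sub_le hv0 hx) hβ0.le
    rcases hS.eq_or_lt with hS | hS
    · rw [← hS]
      exact ⟨hlow, hcon⟩
    · have := ih hr (by linarith) (by linarith) (by rwa [add_sub_cancel])
        (by rwa [add_sub_cancel])
      rw [add_sub_cancel, add_zero] at this
      refine ⟨this.1, fun hlow0 => (this.2 hlow).trans ?_⟩
      have h2 := hcon hlow0
      nlinarith [abs_nonneg (v (T + 1) - x)]

/-- Under the criterion, with `b > 0`, every cycle starts from the fixed point and has one jump. -/
lemma IsCycle.eq_of_singleReduction {β q b x S : ℝ} {v y : ℝ → ℝ} (hβ0 : 0 < β) (hβ1 : β < 1)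
    (hb : 0 < b) (hsr : SingleReduction β q b) (hx : x < b + q)
    (hfix : β * peak q b x = x) (h : IsCycle β q b v y S) :
    v 0 = x ∧ S = overflowTime b (b + q - x) + 1 := by
  have hret := h.first_return.1
  have hv0 := h.traj.init_v
  have hcon := h.traj.contraction hβ0 hβ1 hb hsr hx hfix (⌊S⌋₊ + 1)
    (by exact_mod_cast Nat.lt_floor_add_one S) hret.1 (hret.2.2.trans h.traj.init_y)
    (by rw [hret.2.1]; exact hv0)
  rw [hret.2.1] at hcon
  have hvx : v 0 = x := by
    have := hcon.2 hcon.1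
    have h0 : |v 0 - x| = 0 := by nlinarith [abs_nonneg (v 0 - x)]
    exact sub_eq_zero.1 (abs_eq_zero.1 h0)
  refine ⟨hvx, ?_⟩
  have ha := sub_pos.2 hv0
  obtain ⟨Y, hY⟩ := exists_isProfile q hb.le ha
  have hS := h.overflowTime_le hb.le
  obtain ⟨k, hk, hv⟩ := h.traj.exists_jump hb.le hY hS
  have hy := h.traj.y_jump hb.le hY hS
  have hT0 := overflowTime_pos hb.le ha
  rw [add_overflowTime_eq_peak, hvx] at hk hv
  rw [hvx] at hS hy hT0
  have hk1 := eq_one_of_isLeast (by linarith [le_peak hb.le hx]) (by rwa [hfix]) hk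
  rw [hk1, pow_one, hfix] at hv
  exact le_antisymm (h.first_return.2 ⟨by linarith, by rw [hv, hvx], by rw [hy, h.traj.init_y]⟩) hS

lemma IsCycle.orbit_eq {β q b x S S' : ℝ} {v y v' y' : ℝ → ℝ} (hβ0 : 0 < β) (hβ1 : β < 1)
    (hb : 0 < b) (hsr : SingleReduction β q b) (hx : x < b + q)
    (hfix : β * peak q b x = x) (h : IsCycle β q b v y S) (h' : IsCycle β q b v' y' S') :
    orbit v' y' S' = orbit v y S := by
  obtain ⟨hv, hS⟩ := h.eq_of_singleReduction hβ0 hβ1 hb hsr hx hfix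
  obtain ⟨hv', hS'⟩ := h'.eq_of_singleReduction hβ0 hβ1 hb hsr hx hfix
  obtain ⟨Y, hY⟩ := exists_isProfile q hb.le (sub_pos.2 hx)
  unfold orbit
  rw [hS.trans hS'.symm]
  refine image_congr fun s hs => ?_
  rw [hS'] at hs
  have e1 := h.traj.v_eq_of_lt hb.le (hv ▸ hY) hs.1 (by linarith [hs.2]) (by rw [hv]; exact hs.2)
  have e2 := h.traj.y_eq_of_le hb.le (hv ▸ hY) hs.1 (by linarith [hs.2]) (by rw [hv]; exact hs.2.le)
  have e3 := h'.traj.v_eq_of_lt hb.le (hv' ▸ hY) hs.1 (by linarith [hs.2])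
    (by rw [hv']; exact hs.2)
  have e4 := h'.traj.y_eq_of_le hb.le (hv' ▸ hY) hs.1 (by linarith [hs.2])
    (by rw [hv']; exact hs.2.le)
  rw [e1, e2, e3, e4, hv, hv']

/-! ### Uniqueness without a buffer -/

lemma IsTrajectory.jump_of_zero {β q S : ℝ} {v y : ℝ → ℝ} (hβq : β * (q + 1) < q)
    (h : IsTrajectory β q 0 v y S) (hS : q - v 0 + 1 ≤ S) :
    v (q - v 0 + 1) = β * (q + 1) ∧
      IsTrajectory β q 0 (fun x => v (q - v 0 + 1 + x)) (fun x => y (q - v 0 + 1 + x))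
        (S - (q - v 0 + 1)) := by
  have hv0 := h.init_v
  rw [zero_add] at hv0
  have ha := sub_pos.2 h.init_v
  obtain ⟨Y, hY⟩ := exists_isProfile q le_rfl ha
  have hT : overflowTime 0 (0 + q - v 0) = q - v 0 := by
    linarith [excess_zero ha, show excess 0 (0 + q - v 0) = _ - _ from rfl]
  have hj := h.exists_jump le_rfl hY
  have hr := h.restart le_rfl hY
  rw [hT] at hj hr
  obtain ⟨k, hk, hv⟩ := hj hS
  rw [show v 0 + (q - v 0 + 1) = q + 1 by ring, zero_add] at hk
  rw [show v 0 + (q - v 0 + 1) = q + 1 by ring,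
    eq_one_of_isLeast (by linarith) hβq hk, pow_one] at hv
  exact ⟨hv, hr hS⟩

lemma IsTrajectory.v_eq_of_zero {β q S s : ℝ} {v y : ℝ → ℝ} (h : IsTrajectory β q 0 v y S)
    (hs0 : 0 ≤ s) (hsS : s ≤ S) (hs : s < q - v 0 + 1) : v s = v 0 + s := by
  have ha := sub_pos.2 h.init_v
  obtain ⟨Y, hY⟩ := exists_isProfile q le_rfl ha
  have hT : overflowTime 0 (0 + q - v 0) = q - v 0 := by
    linarith [excess_zero ha, show excess 0 (0 + q - v 0) = _ - _ from rfl]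
  exact h.v_eq_of_lt le_rfl hY hs0 hsS (by rwa [hT])

/-- Without a buffer, `v` never falls below the value that it has after a jump. -/
lemma IsTrajectory.le_v_of_zero {β q : ℝ} (hβq : β * (q + 1) < q) (n : ℕ) :
    ∀ {v y : ℝ → ℝ} {S : ℝ}, IsTrajectory β q 0 v y S → S < n → 0 ≤ S → β * (q + 1) ≤ v 0 →
      β * (q + 1) ≤ v S := by
  induction n with
  | zero =>
    intro v y S _ hS hS0
    rw [Nat.cast_zero] at hS
    linarith
  | succ n ih =>
    intro v y S h hSn hS0 hle
    rw [Nat.cast_add, Nat.cast_one] at hSn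
    have hv0 := h.init_v
    rcases lt_or_ge S (q - v 0 + 1) with hS | hS
    · rw [h.v_eq_of_zero hS0 le_rfl hS]
      linarith
    · obtain ⟨hv, hr⟩ := h.jump_of_zero hβq hS
      have := ih hr (by linarith) (by linarith) (by rw [add_zero, hv])
      rwa [add_sub_cancel] at this

/-- Without a buffer, the orbit does not depend on the cycle.  A cycle may start from any of the
points with `v < q`, so its jump can occur in the middle. -/
lemma IsCycle.orbit_of_zero {β q S : ℝ} {v y : ℝ → ℝ} (hβq : β * (q + 1) < q)
    (h : IsCycle β q 0 v y S) : orbit v y S = Ico (β * (q + 1)) (q + 1) ×ˢ {0} := by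
  have hv0 := h.traj.init_v
  rw [zero_add] at hv0
  obtain ⟨hS0, hvS, -⟩ := h.first_return.1
  have hS : q - v 0 + 1 ≤ S := by
    by_contra hlt
    have := h.traj.v_eq_of_zero hS0.le le_rfl (not_le.1 hlt)
    linarith
  obtain ⟨hv, hr⟩ := h.traj.jump_of_zero hβq hS
  have hy : ∀ s ∈ Icc 0 S, y s = 0 := fun s hs =>
    le_antisymm (h.traj.mem_y s hs).2 (h.traj.mem_y s hs).1
  have hlow : β * (q + 1) ≤ v 0 := by
    have := hr.le_v_of_zero hβq (⌊S - (q - v 0 + 1)⌋₊ + 1)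
      (by exact_mod_cast Nat.lt_floor_add_one _) (by linarith) (by rw [add_zero, hv])
    rwa [add_sub_cancel, hvS] at this
  have hv2 : ∀ s, 0 ≤ s → s ≤ S - (q - v 0 + 1) → s < q - β * (q + 1) + 1 →
      v (q - v 0 + 1 + s) = β * (q + 1) + s := by
    intro s hs0 hsS hs
    have := hr.v_eq_of_zero hs0 hsS (by rwa [add_zero, hv])
    rwa [add_zero, hv] at this
  have hS2 : S = q - v 0 + 1 + (v 0 - β * (q + 1)) := by
    have hle : v 0 - β * (q + 1) ≤ S - (q - v 0 + 1) := by
      by_contra hlt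
      have := hv2 (S - (q - v 0 + 1)) (by linarith) le_rfl (by linarith)
      rw [add_sub_cancel, hvS] at this
      linarith
    refine le_antisymm (h.first_return.2 ⟨by linarith, ?_, ?_⟩) (by linarith)
    · rw [hv2 _ (by linarith) hle (by linarith)]
      ring
    · rw [hy _ ⟨by linarith, by linarith⟩, h.traj.init_y]
  ext ⟨w, z⟩
  simp only [orbit, mem_image, mem_prod, mem_singleton_iff, Prod.mk.injEq]
  constructor
  · rintro ⟨s, hs, rfl, rfl⟩
    refine ⟨?_, hy s ⟨hs.1, hs.2.le⟩⟩
    rcases lt_or_ge s (q - v 0 + 1) with hlt | hge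
    · rw [h.traj.v_eq_of_zero hs.1 hs.2.le hlt]
      exact ⟨by linarith [hs.1], by linarith⟩
    · have := hv2 (s - (q - v 0 + 1)) (by linarith) (by linarith [hs.2]) (by linarith [hs.2])
      rw [add_sub_cancel] at this
      rw [this]
      exact ⟨by linarith, by linarith [hs.2]⟩
  · rintro ⟨hw, rfl⟩
    rcases lt_or_ge w (v 0) with hlt | hge
    · refine ⟨q - v 0 + 1 + (w - β * (q + 1)), ⟨by linarith [hw.1], by linarith⟩, ?_, ?_⟩
      · rw [hv2 _ (by linarith [hw.1]) (by linarith) (by linarith)]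
        ring
      · exact hy _ ⟨by linarith [hw.1], by linarith⟩
    · refine ⟨w - v 0, ⟨by linarith, by linarith [hw.2]⟩, ?_, ?_⟩
      · rw [h.traj.v_eq_of_zero (by linarith) (by linarith [hw.2]) (by linarith [hw.2])]
        ring
      · exact hy _ ⟨by linarith, by linarith [hw.2]⟩

lemma SingleReduction.onlySingleCycleOfOrderOne {β q b : ℝ} (hβ0 : 0 < β) (hβ1 : β < 1)
    (hq : 0 < q) (hb : 0 ≤ b) (h : SingleReduction β q b) : OnlySingleCycleOfOrderOne β q b := by
  have hA : 0 < b + q := by linarith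
  have hβA : β * (b + q) < b + q := by nlinarith
  have hp := le_peak hb hβA
  have hcd : β * (b + q) ≤ β * peak q b (β * (b + q)) :=
    mul_le_mul_of_nonneg_left (by linarith) hβ0.le
  obtain ⟨x, hx, hfix⟩ := exists_fixedPoint (β := β) 1 hcd h (by rwa [pow_one])
    (by rw [pow_one]; exact mul_le_mul_of_nonneg_left (peak_anti h hcd) hβ0.le)
  have hxA : x < b + q := hx.2.trans_lt h
  have hleast : IsLeast {i : ℕ | β ^ i * peak q b x < b + q} 1 := by
    refine ⟨by rw [mem_ofPred_eq, hfix]; exact hxA, fun i hi => ?_⟩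
    by_contra hlt
    have : i = 0 := by omega
    subst this
    simp only [mem_ofPred_eq, pow_zero, one_mul] at hi
    linarith [le_peak hb hxA]
  obtain ⟨v, y, S, hc, -, -⟩ := exists_cycle hb hxA hleast hfix
  rw [pow_one] at hfix
  refine ⟨v, y, S, hc, fun v' y' S' hc' => ?_⟩
  rcases hb.eq_or_lt with rfl | hb'
  · have hβq : β * (q + 1) < q := by
      rw [zero_add] at hβA
      simpa [SingleReduction, peak_zero hβA] using h
    rw [hc'.orbit_of_zero hβq, hc.1.orbit_of_zero hβq]
  · exact hc.1.orbit_eq hβ0 hβ1 hb' h hxA hfix hc'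

/-- The dynamical part of the result: uniqueness is decided by one inequality. -/
theorem onlySingleCycleOfOrderOne_iff {β q b : ℝ} (hβ0 : 0 < β) (hβ1 : β < 1)
    (hq : 0 < q) (hb : 0 ≤ b) : OnlySingleCycleOfOrderOne β q b ↔ SingleReduction β q b :=
  ⟨fun h => h.singleReduction hβ0 hβ1 hq hb, fun h => h.onlySingleCycleOfOrderOne hβ0 hβ1 hq hb⟩

/-! ### The threshold for the buffer that does not run empty -/

lemma tau_two_spec {β : ℝ} (hβ0 : 0 < β) (hβ1 : β < 1) :
    2 * β ≤ tau β 2 ∧ expRatio (tau β 2) = β / (1 + β) * (tau β 2 + 1) + 1 := by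
  have hp : (β ^ (2 - 1) - β ^ 2) / (1 - β ^ 2) = β / (1 + β) := by
    rw [div_eq_div_iff (by nlinarith) (by linarith)]
    ring
  have hp0 : 0 < β / (1 + β) := by positivity
  have hp1 : β / (1 + β) < 1 / 2 := by
    rw [div_lt_div_iff₀ (by linarith) (by norm_num)]
    linarith
  have hiff : ∀ t, 0 < t → (t / (1 + (β ^ (2 - 1) - β ^ 2) / (1 - β ^ 2) * (t + 1)) =
      1 - Real.exp (-t) ↔ expRatio t = β / (1 + β) * (t + 1) + 1) := by
    intro t ht
    rw [hp]
    unfold expRatio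
    have : 0 < β / (1 + β) * (t + 1) := by positivity
    rw [div_eq_iff (by linarith), div_eq_iff (one_sub_exp_neg_pos ht).ne']
    constructor <;> intro h <;> linarith
  obtain ⟨t, ht, hroot⟩ : ∃ t ∈ Icc (2 * β) 3,
      expRatio t - (β / (1 + β) * (t + 1) + 1) = 0 := by
    have hc : ContinuousOn (fun t => expRatio t - (β / (1 + β) * (t + 1) + 1))
        (Icc (2 * β) 3) := by
      refine ContinuousOn.sub (fun t ht => ?_) (by fun_prop)
      exact (hasDerivAt_expRatio (by linarith [ht.1])).continuousAt.continuousWithinAt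
    refine intermediate_value_Icc (by linarith) hc ⟨?_, ?_⟩
    · -- at `2 β` the inequality reduces to `1 + 2 β + (2 β)² / 2 ≤ exp (2 β)`
      have h1 := Real.quadratic_le_exp_of_nonneg (show 0 ≤ 2 * β by linarith)
      have h2 : Real.exp (2 * β) * Real.exp (-(2 * β)) = 1 := by rw [← Real.exp_add]; simp
      have h3 : Real.exp (-(2 * β)) * (1 + 2 * β + (2 * β) ^ 2 / 2) ≤ 1 := by
        have := mul_le_mul_of_nonneg_left h1 (Real.exp_pos (-(2 * β))).le
        linarith
      have h4 : β / (1 + β) * (2 * β + 1) + 1 = (1 + 2 * β + 2 * β ^ 2) / (1 + β) := by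
        field_simp
        ring
      simp only [sub_nonpos]
      unfold expRatio
      rw [h4, div_le_div_iff₀ (one_sub_exp_neg_pos (by linarith)) (by linarith)]
      linarith
    · have h1 : 3 ≤ expRatio 3 := by
        unfold expRatio
        rw [le_div_iff₀ (one_sub_exp_neg_pos (by norm_num))]
        linarith [Real.exp_pos (-3)]
      simp only [sub_nonneg]
      linarith
  have ht0 : 0 < t := by linarith [ht.1]
  have huniq : ∀ s, 0 < s → expRatio s = β / (1 + β) * (s + 1) + 1 → s = t := by
    intro s hs hs'
    rcases lt_trichotomy s t with hlt | heq | hlt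
    · have := half_le_expRatio_sub hs hlt.le
      nlinarith
    · exact heq
    · have := half_le_expRatio_sub ht0 hlt.le
      nlinarith
  have hset : {t : ℝ | 0 < t ∧ t / (1 + (β ^ (2 - 1) - β ^ 2) / (1 - β ^ 2) * (t + 1)) =
      1 - Real.exp (-t)} = {t} := by
    ext s
    simp only [mem_ofPred_eq, mem_singleton_iff]
    constructor
    · rintro ⟨hs, h⟩
      exact huniq s hs ((hiff s hs).1 h)
    · rintro rfl
      exact ⟨ht0, (hiff s ht0).2 (by linarith)⟩
  have htau : tau β 2 = t := by
    unfold tau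
    rw [hset, csInf_singleton]
  rw [htau]
  exact ⟨ht.1, by linarith⟩

lemma one_sub_mul_AStar {β : ℝ} (hβ0 : 0 < β) (hβ1 : β < 1) :
    (1 - β) * AStar β 2 = β / (1 + β) * (tau β 2 + 1) := by
  unfold AStar
  have h1 : 1 - β ^ 2 ≠ 0 := by nlinarith
  have h2 : 1 + β ≠ 0 := by linarith
  field_simp
  ring

lemma lt_AStar {β : ℝ} (hβ0 : 0 < β) (hβ1 : β < 1) : β / (1 - β) < AStar β 2 := by
  have h := (tau_two_spec hβ0 hβ1).1
  unfold AStar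
  rw [show β ^ (2 - 1) = β by norm_num, div_lt_div_iff₀ (by linarith) (by nlinarith)]
  have : 0 < β * (1 - β) * (tau β 2 - β) := by
    apply mul_pos (mul_pos hβ0 (by linarith)) (by linarith)
  nlinarith

lemma AStar_pos {β : ℝ} (hβ0 : 0 < β) (hβ1 : β < 1) : 0 < AStar β 2 :=
  (div_pos hβ0 (by linarith)).trans (lt_AStar hβ0 hβ1)

lemma freeTime_AStar {β : ℝ} (hβ0 : 0 < β) (hβ1 : β < 1) :
    freeTime ((1 - β) * AStar β 2) = tau β 2 := by
  obtain ⟨h1, h2⟩ := tau_two_spec hβ0 hβ1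
  refine freeTime_eq (mul_pos (by linarith) (AStar_pos hβ0 hβ1)) (by linarith) ?_
  rw [h2, one_sub_mul_AStar hβ0 hβ1]

/-- `AStar β 2` is the value of `b + q` at which, without the effect of the empty buffer, the point
`v = β (b + q)` is mapped to `b + q` by a single reduction. -/
lemma AStar_eq {β : ℝ} (hβ0 : 0 < β) (hβ1 : β < 1) :
    β * (AStar β 2 + 1 + (freeTime ((1 - β) * AStar β 2) - (1 - β) * AStar β 2)) = AStar β 2 := by
  rw [freeTime_AStar hβ0 hβ1]
  unfold AStar
  have h1 : 1 - β ^ 2 ≠ 0 := by nlinarith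
  field_simp
  ring

lemma free_lt_iff {β A : ℝ} (hβ0 : 0 < β) (hβ1 : β < 1) (hA : 0 < A) :
    β * (A + 1 + (freeTime ((1 - β) * A) - (1 - β) * A)) < A ↔ AStar β 2 < A := by
  have heq := AStar_eq hβ0 hβ1
  have hA2 := AStar_pos hβ0 hβ1
  have h1β : 0 < 1 - β := by linarith
  have hβ2 : 0 < (1 - β) ^ 2 := by positivity
  constructor
  · intro h
    by_contra hle
    rw [not_lt] at hle
    have := freeTime_sub_le (mul_pos h1β hA) (mul_le_mul_of_nonneg_left hle h1β.le)
    have h2 := mul_le_mul_of_nonneg_left this hβ0.le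
    nlinarith
  · intro h
    have := freeTime_sub_le (mul_pos h1β hA2) (mul_le_mul_of_nonneg_left h.le h1β.le)
    have h2 := mul_le_mul_of_nonneg_left this hβ0.le
    nlinarith

lemma qStar_eq {β : ℝ} (hβ0 : 0 < β) (hβ1 : β < 1) :
    qStar β 2 = AStar β 2 - (1 - β) * AStar β 2 + Real.log (1 + (1 - β) * AStar β 2) := by
  have h := (tau_two_spec hβ0 hβ1).2
  rw [← one_sub_mul_AStar hβ0 hβ1, expRatio, add_comm] at h
  rw [← h]
  unfold qStar AStar
  ring

lemma qStar_le_AStar {β : ℝ} (hβ0 : 0 < β) (hβ1 : β < 1) : qStar β 2 ≤ AStar β 2 := by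
  rw [qStar_eq hβ0 hβ1]
  have h : 0 < (1 - β) * AStar β 2 := mul_pos (by linarith) (AStar_pos hβ0 hβ1)
  linarith [Real.log_le_sub_one_of_pos (show 0 < 1 + (1 - β) * AStar β 2 by linarith)]

/-- The proof uses `2 a / (a + 2) ≤ log (1 + a)` with `a = β (τ + 1) / (1 + β)`, and `2 β ≤ τ`. -/
lemma le_qStar {β : ℝ} (hβ0 : 0 < β) (hβ1 : β < 1) : β / (1 - β) ≤ qStar β 2 := by
  have hτ := (tau_two_spec hβ0 hβ1).1
  have h : 0 < (1 - β) * AStar β 2 := mul_pos (by linarith) (AStar_pos hβ0 hβ1)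
  have hlog := Real.le_log_one_add_of_nonneg h.le
  rw [qStar_eq hβ0 hβ1]
  refine le_trans ?_ (add_le_add_right hlog _)
  rw [one_sub_mul_AStar hβ0 hβ1]
  unfold AStar
  set τ := tau β 2
  have hs : 0 < 1 - β ^ 2 := by nlinarith
  have hd : 0 < 2 + 3 * β + β * τ := by nlinarith
  have e1 : β ^ (2 - 1) * (τ + 1) / (1 - β ^ 2) - β / (1 + β) * (τ + 1) =
      β / (1 - β) - β * (1 - β * τ) / (1 - β ^ 2) := by
    have h1 : 1 - β ≠ 0 := by linarith
    have h2 : 1 + β ≠ 0 := by linarith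
    rw [show 1 - β ^ 2 = (1 - β) * (1 + β) by ring]
    field_simp
    ring
  have e2 : 2 * (β / (1 + β) * (τ + 1)) / (β / (1 + β) * (τ + 1) + 2) =
      2 * β * (τ + 1) / (2 + 3 * β + β * τ) := by
    have h2 : 1 + β ≠ 0 := by linarith
    rw [show β / (1 + β) * (τ + 1) + 2 = (2 + 3 * β + β * τ) / (1 + β) by field_simp; ring]
    field_simp
  have e3 : β * (1 - β * τ) / (1 - β ^ 2) ≤ 2 * β * (τ + 1) / (2 + 3 * β + β * τ) := by
    rw [div_le_div_iff₀ hs hd]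
    have hτ0 : 0 ≤ τ - 2 * β := by linarith
    have : 0 ≤ β * (2 * (τ - 2 * β) + β + β * (τ - 2 * β) + β ^ 2 * τ + β ^ 2 * τ ^ 2) := by
      have : 0 ≤ τ := by linarith
      positivity
    linarith
  linarith

/-! ### The threshold for the buffer that runs empty -/

/-- The quantity `b + q - β W` for `b = refill r`, where `W = q + r + 1` is the value of `v` before
the jump if the buffer has run empty. -/
def gap (β q r : ℝ) : ℝ := refill r + q - β * (q + r + 1)

lemma hasDerivAt_gap (β q r : ℝ) : HasDerivAt (gap β q) (1 - Real.exp (-r) - β) r := by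
  have := ((hasDerivAt_refill r).add_const q).fun_sub
    ((((hasDerivAt_id' r).const_add q).add_const 1).const_mul β)
  rwa [mul_one] at this

lemma continuous_gap (β q : ℝ) : Continuous (gap β q) :=
  continuous_iff_continuousAt.2 fun r => (hasDerivAt_gap β q r).continuousAt

/-- The minimum of `gap` is attained at `r = - log (1 - β)`. -/
lemma gap_strictAntiOn {β : ℝ} (q : ℝ) (hβ1 : β < 1) :
    StrictAntiOn (gap β q) (Iic (-Real.log (1 - β))) := by
  refine strictAntiOn_of_deriv_neg (convex_Iic _) (continuous_gap β q).continuousOn fun r hr => ?_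
  rw [interior_Iic, mem_Iio] at hr
  rw [(hasDerivAt_gap β q r).deriv]
  have := Real.exp_lt_exp.2 (show Real.log (1 - β) < -r by linarith)
  rw [Real.exp_log (by linarith)] at this
  linarith

lemma gap_strictMonoOn {β : ℝ} (q : ℝ) (hβ1 : β < 1) :
    StrictMonoOn (gap β q) (Ici (-Real.log (1 - β))) := by
  refine strictMonoOn_of_deriv_pos (convex_Ici _) (continuous_gap β q).continuousOn fun r hr => ?_
  rw [interior_Ici, mem_Ioi] at hr
  rw [(hasDerivAt_gap β q r).deriv]
  have := Real.exp_lt_exp.2 (show -r < Real.log (1 - β) by linarith)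
  rw [Real.exp_log (by linarith)] at this
  linarith

lemma neg_log_pos {β : ℝ} (hβ0 : 0 < β) (hβ1 : β < 1) : 0 < -Real.log (1 - β) :=
  neg_pos.2 (Real.log_neg (by linarith) (by linarith))

lemma N_eq_one {β q : ℝ} (h : β / (1 - β) < q) : N β q = 1 :=
  le_antisymm (Nat.sInf_le ⟨le_rfl, by simpa using h⟩)
    (le_csInf ⟨1, le_rfl, by simpa using h⟩ fun _ hi => hi.1)

lemma refill_neg_log {β q : ℝ} (hβ1 : β < 1) (h : β / (1 - β) < q) :
    refill (-Real.log (1 - β)) = C β q := by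
  unfold refill C
  rw [N_eq_one h, neg_neg, Real.exp_log (by linarith), pow_one]
  ring

lemma gap_neg_log_nonpos_iff {β q : ℝ} (hβ1 : β < 1) (h : β / (1 - β) < q) :
    gap β q (-Real.log (1 - β)) ≤ 0 ↔ q ≤ D β q := by
  have h1 : 0 < 1 - β := by linarith
  have e1 : gap β q (-Real.log (1 - β)) = (1 - β) * (q - D β q) := by
    unfold gap refill D
    rw [N_eq_one h, neg_neg, Real.exp_log h1, pow_one]
    field_simp
    ring
  rw [e1, mul_nonpos_iff_pos_imp_nonpos]
  constructor
  · rintro ⟨h2, -⟩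
    linarith [h2 h1]
  · exact fun h2 => ⟨fun _ => by linarith, fun _ => h1.le⟩

lemma gap_pos_of_D_lt {β q r : ℝ} (hβ1 : β < 1) (h : β / (1 - β) < q) (hD : D β q < q) :
    0 < gap β q r := by
  have hmin := (gap_neg_log_nonpos_iff hβ1 h).not.2 (not_le.2 hD)
  rw [not_le] at hmin
  refine hmin.trans_le ?_
  rcases le_total r (-Real.log (1 - β)) with hr | hr
  · exact (gap_strictAntiOn q hβ1).antitoneOn hr self_mem_Iic hr
  · exact (gap_strictMonoOn q hβ1).monotoneOn self_mem_Ici hr hr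

lemma gap_zero_pos {β q : ℝ} (hβ1 : β < 1) (h : β / (1 - β) < q) : 0 < gap β q 0 := by
  rw [div_lt_iff₀ (by linarith)] at h
  unfold gap
  rw [refill_zero]
  linarith

lemma gap_zero_nonpos {β q : ℝ} (hβ1 : β < 1) (h : q ≤ β / (1 - β)) : gap β q 0 ≤ 0 := by
  rw [le_div_iff₀ (by linarith)] at h
  unfold gap
  rw [refill_zero]
  linarith

lemma rLow_rHigh_spec {β q : ℝ} (hβ0 : 0 < β) (hβ1 : β < 1) (h : β / (1 - β) < q)
    (hD : q ≤ D β q) :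
    0 < rLow β q ∧ rLow β q ≤ -Real.log (1 - β) ∧ -Real.log (1 - β) ≤ rHigh β q ∧
      gap β q (rLow β q) = 0 ∧ gap β q (rHigh β q) = 0 := by
  have hc0 := neg_log_pos hβ0 hβ1
  have hmin := (gap_neg_log_nonpos_iff hβ1 h).2 hD
  have hanti := gap_strictAntiOn q hβ1
  have hmono := gap_strictMonoOn q hβ1
  set c := -Real.log (1 - β)
  obtain ⟨r₁, hr₁, h₁⟩ := intermediate_value_Icc' hc0.le (continuous_gap β q).continuousOn
    (show (0 : ℝ) ∈ _ from ⟨hmin, (gap_zero_pos hβ1 h).le⟩)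
  have hr₁0 : 0 < r₁ := by
    refine lt_of_le_of_ne hr₁.1 ?_
    rintro rfl
    exact (gap_zero_pos hβ1 h).ne' h₁
  obtain ⟨r₂, hr₂, h₂⟩ : ∃ r ∈ Icc c (c + (1 + β) / (1 - β)), gap β q r = 0 := by
    have hpos : 0 < (1 + β) / (1 - β) := div_pos (by linarith) (by linarith)
    refine intermediate_value_Icc (by linarith) (continuous_gap β q).continuousOn ⟨hmin, ?_⟩
    have e : (1 - β) * ((1 + β) / (1 - β)) = 1 + β := mul_div_cancel₀ _ (by linarith)
    have hq : 0 < q := (div_pos hβ0 (by linarith)).trans h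
    have h1 : 0 < (1 - β) * (c + q) := mul_pos (by linarith) (by linarith)
    have h2 := Real.exp_pos (-(c + (1 + β) / (1 - β)))
    unfold gap refill
    linarith
  have hset : rSolutions β q = {r₁, r₂} := by
    ext r
    have hgap : Real.exp (-r) + r - 1 = β ^ N β q * (q + r + 1) - q ↔ gap β q r = 0 := by
      rw [N_eq_one h, pow_one]
      unfold gap refill
      constructor <;> intro h <;> linarith
    simp only [rSolutions, mem_ofPred_eq, mem_insert_iff, mem_singleton_iff, hgap]
    constructor
    · rintro ⟨-, hr⟩
      rcases le_total r c with hrc | hrc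
      · exact Or.inl (hanti.injOn hrc hr₁.2 (hr.trans h₁.symm))
      · exact Or.inr (hmono.injOn hrc hr₂.1 (hr.trans h₂.symm))
    · rintro (rfl | rfl)
      · exact ⟨hr₁0, h₁⟩
      · exact ⟨hc0.trans_le hr₂.1, h₂⟩
  have hle : r₁ ≤ r₂ := hr₁.2.trans hr₂.1
  have e1 : rLow β q = r₁ := by
    unfold rLow
    rw [hset, csInf_pair, inf_eq_left.2 hle]
  have e2 : rHigh β q = r₂ := by
    unfold rHigh
    rw [hset, csSup_pair, sup_eq_right.2 hle]
  rw [e1, e2]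
  exact ⟨hr₁0, hr₁.2, hr₂.1, h₁, h₂⟩

lemma gap_nonpos_iff {β q r : ℝ} (hβ0 : 0 < β) (hβ1 : β < 1) (h : β / (1 - β) < q)
    (hD : q ≤ D β q) : gap β q r ≤ 0 ↔ r ∈ Icc (rLow β q) (rHigh β q) := by
  obtain ⟨-, h1, h2, h3, h4⟩ := rLow_rHigh_spec hβ0 hβ1 h hD
  have hanti := gap_strictAntiOn q hβ1
  have hmono := gap_strictMonoOn q hβ1
  rcases le_total r (-Real.log (1 - β)) with hr | hr
  · rw [← h3, hanti.le_iff_ge hr h1]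
    exact ⟨fun h => ⟨h, hr.trans h2⟩, fun h => h.1⟩
  · rw [← h4, hmono.le_iff_le hr h2]
    exact ⟨fun h => ⟨h1.trans hr, h⟩, fun h => h.2⟩

lemma gap_fillTime_nonpos_iff {β q b : ℝ} (hβ0 : 0 < β) (hβ1 : β < 1) (hb : 0 ≤ b)
    (h : β / (1 - β) < q) (hD : q ≤ D β q) :
    gap β q (fillTime b) ≤ 0 ↔ b ∈ Icc (bLow β q) (bHigh β q) := by
  obtain ⟨h0, h1, h2, -, -⟩ := rLow_rHigh_spec hβ0 hβ1 h hD
  have hr := fillTime_nonneg b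
  have e1 := refill_strictMonoOn.le_iff_le (a := rLow β q) (b := fillTime b) h0.le hr
  have e2 := refill_strictMonoOn.le_iff_le (a := fillTime b) (b := rHigh β q) hr
    ((h0.trans_le (h1.trans h2)).le)
  rw [refill_fillTime hb] at e1 e2
  rw [gap_nonpos_iff hβ0 hβ1 h hD, mem_Icc, mem_Icc, ← e1, ← e2]
  rfl

lemma C_mem_Icc {β q : ℝ} (hβ0 : 0 < β) (hβ1 : β < 1) (h : β / (1 - β) < q) (hD : q ≤ D β q) :
    C β q ∈ Icc (bLow β q) (bHigh β q) := by
  obtain ⟨h0, h1, h2, -, -⟩ := rLow_rHigh_spec hβ0 hβ1 h hD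
  have hc := neg_log_pos hβ0 hβ1
  rw [← refill_neg_log hβ1 h]
  exact ⟨refill_strictMonoOn.monotoneOn h0.le hc.le h1,
    refill_strictMonoOn.monotoneOn hc.le (h0.trans_le (h1.trans h2)).le h2⟩

lemma C_nonneg {β q : ℝ} (hβ0 : 0 < β) (hβ1 : β < 1) (h : β / (1 - β) < q) : 0 ≤ C β q := by
  rw [← refill_neg_log hβ1 h, ← refill_zero]
  have hc := neg_log_pos hβ0 hβ1
  exact refill_strictMonoOn.monotoneOn self_mem_Ici hc.le hc.le

/-! ### The criterion in terms of the two thresholds -/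

lemma gap_fillTime {β q b : ℝ} (hb : 0 ≤ b) :
    gap β q (fillTime b) = b + q - β * (q + fillTime b + 1) := by
  unfold gap
  rw [refill_fillTime hb]

lemma singleReduction_iff {β q b : ℝ} (hβ0 : 0 < β) (hβ1 : β < 1) (hq : 0 < q) (hb : 0 ≤ b) :
    SingleReduction β q b ↔ AStar β 2 < b + q ∨ 0 < gap β q (fillTime b) := by
  rw [← free_lt_iff hβ0 hβ1 (by linarith), gap_fillTime hb, sub_pos, SingleReduction, peak,
    excess_eq, show b + q - β * (b + q) = (1 - β) * (b + q) by ring, ← min_add_add_left,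
    mul_min_of_nonneg _ _ hβ0.le, min_lt_iff,
    show b + q + 1 + (fillTime b - b) = q + fillTime b + 1 by ring]

/-- At the level `b + q = AStar β 2`, the buffer does not run empty if and only if `q ≤ qStar β 2`.
In that case the second threshold is not passed. -/
lemma gap_AStar_nonpos {β q : ℝ} (hβ0 : 0 < β) (hβ1 : β < 1) (h : q ≤ qStar β 2) :
    gap β q (fillTime (AStar β 2 - q)) ≤ 0 := by
  have hb : 0 ≤ AStar β 2 - q := by linarith [qStar_le_AStar hβ0 hβ1]
  have ha : 0 < (1 - β) * AStar β 2 := mul_pos (by linarith) (AStar_pos hβ0 hβ1)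
  have hT := overflowTime_eq_freeTime hb ha (by linarith [qStar_eq hβ0 hβ1])
  have hle := min_eq_left_iff.1 hT
  have heq := AStar_eq hβ0 hβ1
  rw [gap_fillTime hb]
  nlinarith

lemma gap_AStar_pos {β q : ℝ} (hβ0 : 0 < β) (hβ1 : β < 1) (h : qStar β 2 < q)
    (hqA : q ≤ AStar β 2) : 0 < gap β q (fillTime (AStar β 2 - q)) := by
  have hb : 0 ≤ AStar β 2 - q := by linarith
  have ha : 0 < (1 - β) * AStar β 2 := mul_pos (by linarith) (AStar_pos hβ0 hβ1)
  have hlt := lt_freeTime_of_empty hb ha (by linarith [qStar_eq hβ0 hβ1])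
  have heq := AStar_eq hβ0 hβ1
  rw [gap_fillTime hb]
  nlinarith

/-- For `q ≤ β / (1 - β)` the function `gap` is nonpositive at `0` and at the fill time of the
buffer `AStar β 2 - q`, hence in between. -/
lemma gap_pos_imp {β q b : ℝ} (hβ0 : 0 < β) (hβ1 : β < 1) (hb : 0 ≤ b) (h : q ≤ β / (1 - β))
    (hg : 0 < gap β q (fillTime b)) : AStar β 2 < b + q := by
  by_contra hle
  have h0 := gap_zero_nonpos hβ1 h
  have h1 := gap_AStar_nonpos hβ0 hβ1 (h.trans (le_qStar hβ0 hβ1))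
  have hr : fillTime b ≤ fillTime (AStar β 2 - q) := by
    have hbA : b ≤ AStar β 2 - q := by linarith
    rw [← refill_strictMonoOn.le_iff_le (fillTime_nonneg _) (fillTime_nonneg _),
      refill_fillTime hb, refill_fillTime (hb.trans hbA)]
    exact hbA
  refine hg.not_ge ?_
  rcases le_total (fillTime b) (-Real.log (1 - β)) with hc | hc
  · exact ((gap_strictAntiOn q hβ1).antitoneOn (neg_log_pos hβ0 hβ1).le hc
      (fillTime_nonneg b)).trans h0
  · exact ((gap_strictMonoOn q hβ1).monotoneOn hc (hc.trans hr) hr).trans h1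

lemma conditions_pairwise {β q b : ℝ} (hβ0 : 0 < β) (hβ1 : β < 1) :
    (conditions β q b).Pairwise (fun P Q => ¬ (P ∧ Q)) := by
  have h1 := lt_AStar hβ0 hβ1
  have h2 := qStar_le_AStar hβ0 hβ1
  have h3 : β / (1 - β) < q → 0 ≤ C β q := C_nonneg hβ0 hβ1
  simp only [conditions, List.pairwise_cons, List.mem_cons, List.not_mem_nil, or_false,
    forall_eq_or_imp, forall_eq, CondA, CondB, CondC, CondD, CondE, CondF, max_lt_iff]
  refine ⟨⟨?_, ?_, ?_, ?_, ?_⟩, ⟨?_, ?_, ?_, ?_⟩, ⟨?_, ?_, ?_⟩, ⟨?_, ?_⟩, ?_, by simp⟩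
  · rintro ⟨⟨h, -⟩, h'⟩; linarith
  · rintro ⟨⟨h, -⟩, h', -⟩; linarith
  · rintro ⟨⟨h, -⟩, ⟨h', -⟩, -⟩; linarith
  · rintro ⟨⟨h, -⟩, ⟨h', -⟩, -⟩; linarith
  · rintro ⟨⟨h, -⟩, ⟨⟨h', -⟩, -⟩, -⟩; linarith
  · rintro ⟨h, -, h', -⟩; linarith
  · rintro ⟨h, ⟨h', -⟩, h'', -⟩; linarith [h3 h']
  · rintro ⟨h, ⟨h', -⟩, h'', -⟩; linarith [h3 h']
  · rintro ⟨h, -, h'⟩; linarith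
  · rintro ⟨⟨-, h, -⟩, ⟨-, h'⟩, -⟩; linarith
  · rintro ⟨⟨-, h, -⟩, ⟨-, h'⟩, -⟩; linarith
  · rintro ⟨⟨-, h, -⟩, ⟨⟨-, h'⟩, -⟩, -⟩; linarith
  · rintro ⟨⟨-, -, h, -⟩, -, -, h'⟩; linarith
  · rintro ⟨⟨-, h, -⟩, ⟨-, h'⟩, -⟩; linarith
  · rintro ⟨⟨-, h, -⟩, ⟨-, h'⟩, -⟩; linarith

theorem singleReduction_iff_conditions {β q b : ℝ} (hβ0 : 0 < β) (hβ1 : β < 1) (hq : 0 < q)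
    (hb : 0 ≤ b) : SingleReduction β q b ↔
      CondA β q b ∨ CondB β q ∨ CondC β q b ∨ CondD β q b ∨ CondE β q ∨ CondF β q := by
  have h1 := lt_AStar hβ0 hβ1
  have h2 := qStar_le_AStar hβ0 hβ1
  have hgap := singleReduction_iff hβ0 hβ1 hq hb
  rw [hgap]
  rcases le_or_gt q (β / (1 - β)) with hqβ | hqβ
  · have hA : CondA β q b ↔ AStar β 2 < b + q := ⟨fun h => h.2, fun h => ⟨hqβ, h⟩⟩
    rw [hA]
    constructor
    · exact fun h => Or.inl (h.elim id (gap_pos_imp hβ0 hβ1 hb hqβ))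
    · simp only [CondB, CondC, CondD, CondE, CondF, max_lt_iff]
      rintro (h | h | h | h | h | h)
      · exact Or.inl h
      · linarith
      · linarith [h.1]
      · linarith [h.1.1]
      · linarith [h.1.1]
      · linarith [h.1.1.1]
  have hnA : ¬ CondA β q b := fun h => by linarith [h.1]
  simp only [hnA, false_or]
  rcases lt_or_ge (AStar β 2) q with hqA | hqA
  · exact iff_of_true (Or.inl (by linarith)) (Or.inl hqA)
  have hnB : ¬ CondB β q := hqA.not_gt
  have hb0 : 0 ≤ AStar β 2 - q := by linarith
  simp only [hnB, false_or]
  rcases le_or_gt q (qStar β 2) with hqS | hqS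
  · have hnD : ¬ CondD β q b := fun h => by linarith [(max_lt_iff.1 h.1).2]
    have hnE : ¬ CondE β q := fun h => by linarith [(max_lt_iff.1 h.1).2]
    have hnF : ¬ CondF β q := fun h => by linarith [(max_lt_iff.1 (max_lt_iff.1 h.1).1).2]
    simp only [hnD, hnE, hnF, or_false]
    have hg := gap_AStar_nonpos hβ0 hβ1 hqS
    have hD : q ≤ D β q := not_lt.1 fun hlt => hg.not_gt (gap_pos_of_D_lt hβ1 hqβ hlt)
    rw [gap_fillTime_nonpos_iff hβ0 hβ1 hb0 hqβ hD] at hg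
    rw [← not_le (b := (0 : ℝ)), gap_fillTime_nonpos_iff hβ0 hβ1 hb hqβ hD]
    simp only [CondC, hqβ, hqS, true_and, mem_Icc, not_and_or, not_le]
    constructor
    · rintro (h | h | h)
      · exact Or.inr (by linarith)
      · exact Or.inl h
      · exact Or.inr (hg.2.trans_lt h)
    · rintro (h | h)
      · exact Or.inr (Or.inl h)
      · exact Or.inl (by linarith)
  have hnC : ¬ CondC β q b := fun h => by linarith [h.2.1]
  simp only [hnC, false_or]
  have hg := gap_AStar_pos hβ0 hβ1 hqS hqA
  rcases le_or_gt q (AStar β 2 - C β q) with hqC | hqC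
  · have hnF : ¬ CondF β q := fun h => by linarith [(max_lt_iff.1 h.1).2]
    rcases lt_or_ge (D β q) q with hD | hD
    · exact iff_of_true (Or.inr (gap_pos_of_D_lt hβ1 hqβ hD))
        (Or.inr (Or.inl ⟨max_lt hqβ hqS, hqC, hD⟩))
    · have hnE : ¬ CondE β q := fun h => by linarith [h.2.2]
      have hC := C_mem_Icc hβ0 hβ1 hqβ hD
      rw [← not_le, gap_fillTime_nonpos_iff hβ0 hβ1 hb0 hqβ hD] at hg
      -- the level `AStar β 2 - q` lies above the minimum of `gap`, hence above `bHigh β q`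
      have hhigh : bHigh β q < AStar β 2 - q :=
        not_le.1 fun h => hg ⟨hC.1.trans (by linarith), h⟩
      rw [← not_le (b := (0 : ℝ)), gap_fillTime_nonpos_iff hβ0 hβ1 hb hqβ hD]
      simp only [hnE, hnF, or_false, CondD, max_lt hqβ hqS, hqC, hD, true_and]
      refine ⟨?_, Or.inr⟩
      rintro (h | h)
      · exact fun hmem => by linarith [hmem.2]
      · exact h
  · refine iff_of_true ?_ (Or.inr (Or.inr ⟨max_lt (max_lt hqβ hqS) hqC, hqA⟩))
    rcases lt_or_ge (D β q) q with hD | hD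
    · exact Or.inr (gap_pos_of_D_lt hβ1 hqβ hD)
    have hC := C_mem_Icc hβ0 hβ1 hqβ hD
    rw [← not_le, gap_fillTime_nonpos_iff hβ0 hβ1 hb0 hqβ hD] at hg
    -- the level `AStar β 2 - q` lies below the minimum of `gap`, hence below `bLow β q`
    have hlow : AStar β 2 - q < bLow β q :=
      not_le.1 fun h => hg ⟨h, le_trans (by linarith) hC.2⟩
    rw [← not_le (b := (0 : ℝ)), gap_fillTime_nonpos_iff hβ0 hβ1 hb hqβ hD]
    rcases lt_or_ge (AStar β 2) (b + q) with hlt | hge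
    · exact Or.inl hlt
    · exact Or.inr fun hmem => by linarith [hmem.1]

end TCPBuffer

end

/-- The conditions (a)–(f) are mutually exclusive, and one of them holds if and only if only a single
cycle of order `1` exists. -/
theorem mainTheorem3 (β q b : ℝ) (hβ0 : 0 < β) (hβ1 : β < 1) (hq : 0 < q) (hb : 0 ≤ b) :
    (TCPBuffer.conditions β q b).Pairwise (fun P Q => ¬ (P ∧ Q)) ∧
      (TCPBuffer.OnlySingleCycleOfOrderOne β q b ↔
        TCPBuffer.CondA β q b ∨ TCPBuffer.CondB β q ∨ TCPBuffer.CondC β q b ∨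
          TCPBuffer.CondD β q b ∨ TCPBuffer.CondE β q ∨ TCPBuffer.CondF β q) :=
  ⟨TCPBuffer.conditions_pairwise hβ0 hβ1,
    (TCPBuffer.onlySingleCycleOfOrderOne_iff hβ0 hβ1 hq hb).trans
      (TCPBuffer.singleReduction_iff_conditions hβ0 hβ1 hq hb)⟩
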